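/- Let $X$ be a (real or complex) Banach space with a Schauder basis $(e_n)_{n\in\mathbb N}$. Call $X$ *ergodic* if the relation $E_0$ of eventual agreement on $\{0,1\}^{\mathbb N}$ Borel reduces to isomorphism of closed subspaces of $X$, i.e. if there is a Borel map $f$ from $\{0,1\}^{\mathbb N}$ to the set of closed linear subspaces of $X$, equipped with its Effros-Borel structure, such that for all $\alpha,\beta$ one has $\alpha E_0\beta$ if and only if $f(\alpha)$ and $f(\beta)$ are linearly isomorphic. The support of $x=\sum_n x_n e_n$ is $\{n : x_n\neq 0\}$, and for subspaces $F,G$ of $X$ write $F<G$ if $m<n$ whenever $m$ is in the support of some $x\in F$ and $n$ is in the support of some $y\in G$. A sequence of nonzero finite-dimensional subspaces $(E_k)_{k\in\mathbb N}$ of $X$ is *successive* if $E_k<E_{k+1}$ for all $k$; the closed linear span $\bigoplus_k E_k$ of such a sequence is a *space with a finite-dimensional decomposition on the basis*, and it *passes through* $F$ if $E_k=F$ for some $k$. Two subspaces $Y,Z$ are *$K$-isomorphic* if there is a linear isomorphism $T:Y\to Z$ with $\|T\|\,\|T^{-1}\|\le K$. Then either $X$ is ergodic, or there exist a constant $K\ge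 1$ and a successive sequence $(F_n)_{n\in\mathbb N}$ of nonzero finite-dimensional subspaces of $X$ such that all spaces with a finite-dimensional decomposition on the basis passing through infinitely many of the $F_n$ are mutually $K$-isomorphic. -/

import Mathlib

namespace ErgodicBanach

section Reducibility

/-- Eventual agreement of infinite binary sequences: the relation `E₀` on `2^ℕ`. -/
def E₀ (x y : ℕ → Bool) : Prop :=
  ∃ n, ∀ m, n ≤ m → x m = y m

/-- `E` Borel reduces to `F`: there is a Borel map `f` with `x E y ↔ f x F f y`. -/
def BorelReduces {α β : Type*} [MeasurableSpace α] [MeasurableSpace β]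
    (E : α → α → Prop) (F : β → β → Prop) : Prop :=
  ∃ f : α → β, Measurable f ∧ ∀ x y, E x y ↔ F (f x) (f y)

end Reducibility

section Subspaces

variable {𝕜 : Type*} [RCLike 𝕜] {X : Type*} [NormedAddCommGroup X] [NormedSpace 𝕜 X]

/-- The Effros-Borel structure on the set of closed linear subspaces of `X`: the σ-algebra
generated by the sets `{Y | Y ∩ U ≠ ∅}` with `U` open in `X`. -/
instance effrosBorel : MeasurableSpace (ClosedSubmodule 𝕜 X) :=
  MeasurableSpace.generateFrom
    {S | ∃ U : Set X, IsOpen U ∧ S = {Y : ClosedSubmodule 𝕜 X | ((Y : Set X) ∩ U).Nonempty}}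

/-- Linear isomorphism (with continuous inverse) of closed subspaces. -/
def Isomorphic (Y Z : ClosedSubmodule 𝕜 X) : Prop :=
  Nonempty (Y.toSubmodule ≃L[𝕜] Z.toSubmodule)

/-- `Y` and `Z` are `K`-isomorphic: there is an isomorphism `T` of `Y` onto `Z` with
`‖T‖ * ‖T⁻¹‖ ≤ K`. -/
def IsKIsomorphic (K : ℝ) (Y Z : ClosedSubmodule 𝕜 X) : Prop :=
  ∃ T : Y.toSubmodule ≃L[𝕜] Z.toSubmodule,
    ‖(T : Y.toSubmodule →L[𝕜] Z.toSubmodule)‖ *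
      ‖(T.symm : Z.toSubmodule →L[𝕜] Y.toSubmodule)‖ ≤ K

variable (𝕜 X) in
/-- `X` is ergodic: `E₀` Borel reduces to isomorphism between closed subspaces of `X`. -/
def IsErgodic : Prop :=
  BorelReduces E₀ (Isomorphic : ClosedSubmodule 𝕜 X → ClosedSubmodule 𝕜 X → Prop)

/-- The support of a vector on the basis. -/
def supp (e : SchauderBasis 𝕜 X) (x : X) : Set ℕ :=
  {n | e.coord n x ≠ 0}

/-- `F < G`: for all `x ∈ F` and `y ∈ G`, the support of `x` lies before that of `y`. -/
def Successive (e : SchauderBasis 𝕜 X) (F G : Submodule 𝕜 X) : Prop :=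
  ∀ x ∈ F, ∀ y ∈ G, ∀ m ∈ supp e x, ∀ n ∈ supp e y, m < n

/-- An infinite sequence of successive (nonzero) finite-dimensional subspaces of `X`. -/
structure IsFDDSeq (e : SchauderBasis 𝕜 X) (E : ℕ → Submodule 𝕜 X) : Prop where
  finiteDimensional : ∀ k, FiniteDimensional 𝕜 (E k)
  ne_bot : ∀ k, E k ≠ ⊥
  successive : ∀ k, Successive e (E k) (E (k + 1))

/-- The space `⊕ₖ Eₖ`, that is, the closed linear span of the `Eₖ`. -/
def fddSpace (E : ℕ → Submodule 𝕜 X) : ClosedSubmodule 𝕜 X :=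
  (⨆ k, E k).closure

/-- The decomposition `(Eₖ)` passes through infinitely many of the `Fₙ`. -/
def PassesThroughInfinitelyMany (E F : ℕ → Submodule 𝕜 X) : Prop :=
  {n | ∃ k, E k = F n}.Infinite

end Subspaces

end ErgodicBanach

open Set Topology Filter MeasureTheory

/-! Fix a countable net of finite-dimensional subspaces, each labelled and carried by an interval
(`BlockNet`). A set of labels with pairwise disjoint intervals is a point of a compact space
`BlockNet.Space` and codes the closed span of its subspaces. For each natural number L, the pairs of
points whose closed spans are isomorphic with both norms at most L form an analytic set
(`analyticSet_isoWithin_span`). The theorem is a dichotomy on the Baire category of these sets.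

If all of them are meagre, so is their union, and a sequence of decreasing dense open sets of pairs
avoids it. One builds successive pairs of finite blocks of equal rank such that choosing different
blocks at stage n forces the pair of points, in the right order, into the n-th open set, whatever
was chosen before. Choices that eventually agree give spaces that differ by finite-dimensional
pieces of equal dimension, hence isomorphic ones. Choices that differ infinitely often give
nonisomorphic ones. This reduces `E₀` (`isErgodic_of_isMeagre`).

If the set for some L is not meagre, it is comeagre in a nonempty open set, and by Kuratowski-Ulam
there are a point x and a cylinder in which almost every point is L-isomorphic to x
(`exists_generic_cyl`). An `Anchor` is a sequence of blocks such that a point of this cylinder that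
follows infinitely many of them is generic in this sense. The Fₙ are the spans of these blocks. A
decomposition passing through infinitely many Fₙ is uniformly isomorphic to such a point
(`Anchor.exists_isoWithin`): an initial piece of fixed dimension is exchanged for the stem of the
cylinder together with a filler in a gap left inside one anchor block, and the remaining terms are
perturbed into the net, the anchor blocks being left alone. All these spaces are therefore uniformly
isomorphic to the span of x. -/

namespace ErgodicBanach

/-! ### Baire category: analytic sets and a Kuratowski-Ulam argument. -/

section Category

variable {X : Type*} [TopologicalSpace X]

/-- The points at which `A` is everywhere locally non-meagre. -/
def nonmeagreCore (A : Set X) : Set X :=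
  {x | ∀ U : Set X, IsOpen U → x ∈ U → ¬ IsMeagre (A ∩ U)}

theorem isClosed_nonmeagreCore (A : Set X) : IsClosed (nonmeagreCore A) := by
  rw [← isOpen_compl_iff, isOpen_iff_forall_mem_open]
  intro x hx
  simp only [nonmeagreCore, mem_compl_iff, mem_ofPred_eq, not_forall, not_not] at hx
  obtain ⟨U, hU, hxU, hm⟩ := hx
  exact ⟨U, fun y hy h => h U hU hy hm, hU, hxU⟩

theorem isMeagre_diff_nonmeagreCore [SecondCountableTopology X] (A : Set X) :
    IsMeagre (A \ nonmeagreCore A) := by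
  have hB := TopologicalSpace.isBasis_countableBasis X
  have hc := TopologicalSpace.countable_countableBasis X
  refine IsMeagre.mono ?_ (isMeagre_biUnion (I := {V ∈ TopologicalSpace.countableBasis X |
    IsMeagre (A ∩ V)}) (hc.mono fun _ h => h.1) (f := fun V => A ∩ V) fun V hV => hV.2)
  rintro x ⟨hxA, hx⟩
  simp only [nonmeagreCore, mem_ofPred_eq, not_forall, not_not] at hx
  obtain ⟨U, hU, hxU, hm⟩ := hx
  obtain ⟨V, hV, hxV, hVU⟩ := hB.exists_subset_of_mem_open hxU hU
  exact mem_biUnion (x := V) ⟨hV, hm.mono (inter_subset_inter_right _ hVU)⟩ ⟨hxA, hxV⟩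

theorem isMeagre_diff_interior {F : Set X} (hF : IsClosed F) : IsMeagre (F \ interior F) := by
  rw [← hF.frontier_eq]
  refine IsNowhereDense.isMeagre ?_
  rw [isClosed_frontier.isNowhereDense_iff, interior_frontier hF]

theorem isMeagre_closure_diff {W : Set X} (hW : IsOpen W) : IsMeagre (closure W \ W) := by
  rw [← hW.frontier_eq]
  refine IsNowhereDense.isMeagre ?_
  rw [isClosed_frontier.isNowhereDense_iff, ← frontier_compl, interior_frontier hW.isClosed_compl]

/-- Off the closure of the union W of the interiors of the cores of the pieces, each piece is
meagre, so no open set there can lie in the core of the union. Boundaries of open and closed sets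
account for the rest. -/
theorem isMeagre_nonmeagreCore_iUnion_diff [SecondCountableTopology X] {ι : Type*} [Countable ι]
    (A : ι → Set X) :
    IsMeagre (nonmeagreCore (⋃ i, A i) \ ⋃ i, nonmeagreCore (A i)) := by
  set D := nonmeagreCore (⋃ i, A i)
  set W := ⋃ i, interior (nonmeagreCore (A i))
  have hW : IsOpen W := isOpen_iUnion fun i => isOpen_interior
  have key : interior D \ closure W = ∅ := by
    by_contra hne
    obtain ⟨x, hx⟩ := nonempty_iff_ne_empty.2 hne
    refine (interior_subset hx.1 : x ∈ D) (interior D \ closure W)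
      (isOpen_interior.sdiff isClosed_closure) hx ?_
    refine IsMeagre.mono (s := ⋃ i, ((A i \ nonmeagreCore (A i)) ∪
      (nonmeagreCore (A i) \ interior (nonmeagreCore (A i))))) ?_
      (isMeagre_iUnion fun i : ι => (isMeagre_diff_nonmeagreCore _).union
        (isMeagre_diff_interior (isClosed_nonmeagreCore _)))
    rintro y ⟨hy, -, hyW⟩
    obtain ⟨i, hi⟩ := mem_iUnion.1 hy
    refine mem_iUnion.2 ⟨i, ?_⟩
    by_cases h : y ∈ nonmeagreCore (A i)
    · exact Or.inr ⟨h, fun h' => hyW (subset_closure (mem_iUnion.2 ⟨i, h'⟩))⟩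
    · exact Or.inl ⟨hi, h⟩
  refine IsMeagre.mono ?_ ((isMeagre_diff_interior (isClosed_nonmeagreCore (⋃ i, A i))).union
    (isMeagre_closure_diff hW))
  rintro x ⟨hxD, hx⟩
  by_cases h : x ∈ interior D
  · right
    refine ⟨by_contra fun h' => (key ▸ (⟨h, h'⟩ : x ∈ interior D \ closure W) : x ∈ (∅ : Set X)),
      fun h' => hx ?_⟩
    obtain ⟨i, hi⟩ := mem_iUnion.1 h'
    exact mem_iUnion.2 ⟨i, interior_subset hi⟩
  · exact Or.inl ⟨hxD, h⟩

theorem exists_branch {p : List ℕ → Prop} (h0 : p []) (hs : ∀ s, p s → ∃ i, p (s ++ [i])) :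
    ∃ w : ℕ → ℕ, ∀ n, p ((List.range n).map w) := by
  have : ∀ s, ∃ i, p s → p (s ++ [i]) := fun s => by
    by_cases h : p s
    · exact (hs s h).imp fun _ hi _ => hi
    · exact ⟨0, fun h' => absurd h' h⟩
  choose g hg using this
  let s : ℕ → List ℕ := fun n => Nat.rec [] (fun _ l => l ++ [g l]) n
  have hsw : ∀ n, s n = (List.range n).map fun k => g (s k) := by
    intro n
    induction n with
    | zero => rfl
    | succ n ih => rw [List.range_succ, List.map_append, ← ih]; rfl
  refine ⟨fun n => g (s n), fun n => hsw n ▸ ?_⟩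
  induction n with
  | zero => exact h0
  | succ n ih => exact hg _ ih

/-- Analytic sets have the Baire property; we only need that a non-meagre analytic set is
comeagre in some nonempty open set. -/
theorem exists_isOpen_isMeagre_diff [SecondCountableTopology X] [T2Space X] {A : Set X}
    (hA : AnalyticSet A) (h : ¬ IsMeagre A) :
    ∃ U : Set X, IsOpen U ∧ U.Nonempty ∧ IsMeagre (U \ A) := by
  rw [AnalyticSet] at hA
  obtain rfl | ⟨f, hf, rfl⟩ := hA
  · exact absurd IsMeagre.empty h
  let P : List ℕ → Set X := fun s => f '' {w | (List.range s.length).map w = s}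
  have hP0 : P [] = range f := by simp [P]
  have hP : ∀ s, P s = ⋃ i, P (s ++ [i]) := by
    intro s
    ext x
    simp only [P, mem_iUnion, mem_image, mem_ofPred_eq, List.length_append, List.length_cons,
      List.length_nil, zero_add, List.range_succ, List.map_append, List.map_cons, List.map_nil]
    constructor
    · rintro ⟨w, hw, rfl⟩
      exact ⟨w s.length, w, by rw [hw], rfl⟩
    · rintro ⟨i, w, hw, rfl⟩
      exact ⟨w, (List.append_inj hw (by simp)).1, rfl⟩
  -- A point outside Q in the core of `P s` is in the core of some `P (s ++ [i])`, so it follows an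
  -- infinite branch w of cores. Only countably many s occur, hence Q is meagre.
  let Q := ⋃ s, nonmeagreCore (P s) \ ⋃ i, nonmeagreCore (P (s ++ [i]))
  have hQ : IsMeagre Q := isMeagre_iUnion fun s => by
    rw [hP s]; exact isMeagre_nonmeagreCore_iUnion_diff _
  have hsub : nonmeagreCore (range f) \ Q ⊆ range f := by
    rintro x ⟨hx, hxQ⟩
    obtain ⟨w, hw⟩ := exists_branch (p := fun s => x ∈ nonmeagreCore (P s)) (hP0 ▸ hx)
      fun s hs => by
        by_contra hcon
        exact hxQ (mem_iUnion.2 ⟨s, hs, fun h' => hcon (mem_iUnion.1 h')⟩)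
    refine ⟨w, ?_⟩
    -- If `f w` differed from x, continuity would put some `P s` on the branch inside an open set
    -- disjoint from a neighbourhood of x, although x is in the core of that `P s`.
    by_contra hne
    obtain ⟨U, V, hU, hV, hwU, hxV, hUV⟩ := t2_separation hne
    have hmem : f ⁻¹' U ∈ 𝓝 w := hf.continuousAt.preimage_mem_nhds (hU.mem_nhds hwU)
    obtain ⟨n, hn⟩ : ∃ n, ∀ v : ℕ → ℕ, (∀ i < n, v i = w i) → f v ∈ U := by
      obtain ⟨n, hn⟩ := (PiNat.isTopologicalBasis_cylinders (fun _ : ℕ => ℕ)).mem_nhds_iff.1 hmem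
      obtain ⟨⟨y, k, rfl⟩, hwy, hsubU⟩ := hn
      refine ⟨k, fun v hv => hsubU ?_⟩
      rw [PiNat.mem_cylinder_iff] at hwy ⊢
      exact fun i hi => (hv i hi).trans (hwy i hi)
    refine hw n V hV hxV ?_
    convert IsMeagre.empty (X := X)
    rw [eq_empty_iff_forall_notMem]
    rintro _ ⟨⟨v, hv, rfl⟩, hvV⟩
    refine disjoint_left.1 hUV (hn v fun i hi => ?_) hvV
    simp only [mem_ofPred_eq, List.length_map, List.length_range] at hv
    have := congrArg (fun l : List ℕ => l[i]?) hv
    simpa [hi] using this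
  refine ⟨interior (nonmeagreCore (range f)), isOpen_interior, ?_, ?_⟩
  · by_contra hne
    rw [not_nonempty_iff_eq_empty] at hne
    refine h (IsMeagre.mono ?_ ((isMeagre_diff_nonmeagreCore (range f)).union
      (isMeagre_diff_interior (isClosed_nonmeagreCore (range f)))))
    intro x hx
    by_cases hx' : x ∈ nonmeagreCore (range f)
    · exact Or.inr ⟨hx', by simp [hne]⟩
    · exact Or.inl ⟨hx, hx'⟩
  · refine hQ.mono ?_
    rintro x ⟨hx, hxA⟩
    by_contra hxQ
    exact hxA (hsub ⟨interior_subset hx, hxQ⟩)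

/-- One half of the Kuratowski-Ulam theorem. -/
theorem exists_isMeagre_section {Y : Type*} [TopologicalSpace Y] [SecondCountableTopology Y]
    [BaireSpace X] {W : Set (X × Y)} (hW : IsMeagre W) {U : Set X} (hU : IsOpen U)
    (hne : U.Nonempty) : ∃ x ∈ U, IsMeagre {y | (x, y) ∈ W} := by
  obtain ⟨S, hSo, hSd, hSc, hS⟩ := mem_residual_iff.1 hW
  have hB := TopologicalSpace.isBasis_countableBasis Y
  have hBc := TopologicalSpace.countable_countableBasis Y
  -- These countably many projections are open and dense. At a point common to all of them, the
  -- section of every member of S meets every basic open set.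
  let G : Set (X × Y) × Set Y → Set X := fun a => {x | ∃ y ∈ a.2, (x, y) ∈ a.1}
  have hGo : ∀ a ∈ S ×ˢ TopologicalSpace.countableBasis Y, IsOpen (G a) ∧ Dense (G a) := by
    rintro ⟨O, V⟩ ⟨hO, hV⟩
    have hVo := TopologicalSpace.isOpen_of_mem_countableBasis hV
    have hVne := TopologicalSpace.nonempty_of_mem_countableBasis hV
    have hGim : ∀ R : Set X, Prod.fst '' (O ∩ R ×ˢ V) = G (O, V) ∩ R := by
      intro R; ext x
      constructor
      · rintro ⟨⟨x, y⟩, ⟨h1, h2, h3⟩, rfl⟩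
        exact ⟨⟨y, h3, h1⟩, h2⟩
      · rintro ⟨⟨y, h3, h1⟩, h2⟩
        exact ⟨(x, y), ⟨h1, h2, h3⟩, rfl⟩
    constructor
    · have := isOpenMap_fst _ ((hSo O hO).inter (isOpen_univ.prod hVo))
      rwa [hGim, inter_univ] at this
    · rw [dense_iff_inter_open]
      intro R hR hRne
      obtain ⟨z, hz⟩ := (hSd O hO).inter_open_nonempty (R ×ˢ V) (hR.prod hVo) (hRne.prod hVne)
      exact ⟨z.1, hz.1.1, z.2, hz.1.2, hz.2⟩
  have hres : (⋂ a ∈ S ×ˢ TopologicalSpace.countableBasis Y, G a) ∈ residual X :=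
    (countable_bInter_mem (hSc.prod hBc)).2 fun a ha =>
      residual_of_dense_open (hGo a ha).1 (hGo a ha).2
  obtain ⟨x, hxU, hx⟩ := (dense_of_mem_residual hres).inter_open_nonempty U hU hne
  refine ⟨x, hxU, mem_residual_iff.2 ⟨(fun O => {y | (x, y) ∈ O}) '' S, ?_, ?_, hSc.image _, ?_⟩⟩
  · rintro _ ⟨O, hO, rfl⟩
    exact (hSo O hO).preimage (by fun_prop : Continuous fun y : Y => (x, y))
  · rintro _ ⟨O, hO, rfl⟩
    rw [hB.dense_iff]
    intro V hV _
    obtain ⟨y, hyV, hy⟩ := mem_iInter₂.1 hx (O, V) ⟨hO, hV⟩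
    exact ⟨y, hyV, hy⟩
  · intro y hy hyW
    refine hS (fun O hO => ?_ : (x, y) ∈ ⋂₀ S) hyW
    exact hy _ ⟨O, hO, rfl⟩

theorem exists_antitone_dense_of_isMeagre {M : Set X} (hM : IsMeagre M) :
    ∃ O : ℕ → Set X, (∀ n, IsOpen (O n)) ∧ (∀ n, Dense (O n)) ∧ Antitone O ∧
      ∀ x, (∀ n, x ∈ O n) → x ∉ M := by
  obtain ⟨S, hSo, hSd, hSc, hS⟩ := mem_residual_iff.1 hM
  obtain ⟨g, hg⟩ := (hSc.insert univ).exists_eq_range ⟨univ, mem_insert _ _⟩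
  have hgS : ∀ n, g n = univ ∨ g n ∈ S := fun n => (hg ▸ mem_range_self n : g n ∈ insert univ S)
  have hgo : ∀ n, IsOpen (g n) := fun n => (hgS n).elim (fun h => h ▸ isOpen_univ) (hSo _)
  have hgd : ∀ n, Dense (g n) := fun n => (hgS n).elim (fun h => h ▸ dense_univ) (hSd _)
  refine ⟨fun n => ⋂ i ∈ Finset.range n, g i, fun n => ?_, fun n => ?_, fun m n hmn => ?_,
    fun x hx => ?_⟩
  · exact isOpen_biInter_finset fun i _ => hgo i
  · induction n with
    | zero => simp
    | succ n ih =>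
      simp only [Finset.range_add_one, Finset.set_biInter_insert]
      exact (hgd n).inter_of_isOpen_left ih (hgo n)
  · exact biInter_subset_biInter_left fun i hi => by simp at hi ⊢; omega
  · refine hS fun O hO => ?_
    obtain ⟨n, hn⟩ : O ∈ range g := hg ▸ mem_insert_of_mem _ hO
    have := mem_iInter₂.1 (hx (n + 1)) n (by simp)
    rwa [hn] at this

end Category

end ErgodicBanach

namespace ErgodicBanach

/-! ### Isomorphisms given by graphs, and exchanges of finite-dimensional summands. -/

section IsoWithin

variable {𝕜 : Type*} [RCLike 𝕜] {X : Type*} [NormedAddCommGroup X] [NormedSpace 𝕜 X]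

/-- `Y` and `Z` are isomorphic by an isomorphism of norm at most `L`, the inverse of which has norm
at most `L`. The isomorphism is given by its graph. -/
def IsoWithin (L : ℝ) (Y Z : Submodule 𝕜 X) : Prop :=
  ∃ Γ : Submodule 𝕜 (X × X), Γ.map (LinearMap.fst 𝕜 X X) = Y ∧ Γ.map (LinearMap.snd 𝕜 X X) = Z ∧
    ∀ p ∈ Γ, ‖p.1‖ ≤ L * ‖p.2‖ ∧ ‖p.2‖ ≤ L * ‖p.1‖

theorem IsoWithin.symm {L : ℝ} {Y Z : Submodule 𝕜 X} (h : IsoWithin L Y Z) : IsoWithin L Z Y := by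
  obtain ⟨Γ, rfl, rfl, hΓ⟩ := h
  refine ⟨Γ.map (LinearEquiv.prodComm 𝕜 X X).toLinearMap, ?_, ?_, ?_⟩
  · rw [← Submodule.map_comp]; rfl
  · rw [← Submodule.map_comp]; rfl
  · rintro _ ⟨p, hp, rfl⟩
    exact (hΓ p hp).symm

theorem IsoWithin.trans {L M : ℝ} (hL : 0 ≤ L) (hM : 0 ≤ M) {Y Z W : Submodule 𝕜 X}
    (h : IsoWithin L Y Z) (h' : IsoWithin M Z W) : IsoWithin (L * M) Y W := by
  obtain ⟨Γ, rfl, rfl, hΓ⟩ := h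
  obtain ⟨Δ, hΔ1, rfl, hΔ⟩ := h'
  refine ⟨{ carrier := {p | ∃ y, (p.1, y) ∈ Γ ∧ (y, p.2) ∈ Δ}
            add_mem' := ?_, zero_mem' := ⟨0, Γ.zero_mem, Δ.zero_mem⟩, smul_mem' := ?_ }, ?_, ?_, ?_⟩
  · rintro p q ⟨y, h1, h2⟩ ⟨z, h3, h4⟩
    exact ⟨y + z, Γ.add_mem h1 h3, Δ.add_mem h2 h4⟩
  · rintro c p ⟨y, h1, h2⟩
    exact ⟨c • y, Γ.smul_mem c h1, Δ.smul_mem c h2⟩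
  · ext x
    constructor
    · rintro ⟨p, ⟨y, h1, -⟩, rfl⟩
      exact ⟨_, h1, rfl⟩
    · rintro ⟨⟨x, y⟩, h1, rfl⟩
      obtain ⟨⟨y', z⟩, h2, rfl⟩ : y ∈ Δ.map (LinearMap.fst 𝕜 X X) := hΔ1 ▸ ⟨_, h1, rfl⟩
      exact ⟨(x, z), ⟨y', h1, h2⟩, rfl⟩
  · ext z
    constructor
    · rintro ⟨p, ⟨y, -, h2⟩, rfl⟩
      exact ⟨_, h2, rfl⟩
    · rintro ⟨⟨y, z⟩, h2, rfl⟩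
      obtain ⟨⟨x, y'⟩, h1, rfl⟩ : y ∈ Γ.map (LinearMap.snd 𝕜 X X) := hΔ1 ▸ ⟨_, h2, rfl⟩
      exact ⟨(x, z), ⟨y', h1, h2⟩, rfl⟩
  · rintro p ⟨y, h1, h2⟩
    have ha := hΓ _ h1
    have hb := hΔ _ h2
    constructor
    · calc ‖p.1‖ ≤ L * ‖y‖ := ha.1
        _ ≤ L * (M * ‖p.2‖) := by gcongr; exact hb.1
        _ = _ := by ring
    · calc ‖p.2‖ ≤ M * ‖y‖ := hb.2
        _ ≤ M * (L * ‖p.1‖) := by gcongr; exact ha.2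
        _ = _ := by ring

theorem IsoWithin.mono {L M : ℝ} (hLM : L ≤ M) {Y Z : Submodule 𝕜 X}
    (h : IsoWithin L Y Z) : IsoWithin M Y Z := by
  obtain ⟨Γ, h1, h2, hΓ⟩ := h
  refine ⟨Γ, h1, h2, fun p hp => ⟨(hΓ p hp).1.trans ?_, (hΓ p hp).2.trans ?_⟩⟩ <;> gcongr

theorem isoWithin_of_linearMap {L : ℝ} (S : X →ₗ[𝕜] X) (Y : Submodule 𝕜 X)
    (hS : ∀ y ∈ Y, ‖y‖ ≤ L * ‖S y‖ ∧ ‖S y‖ ≤ L * ‖y‖) : IsoWithin L Y (Y.map S) := by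
  refine ⟨Y.map (LinearMap.id.prod S), ?_, ?_, ?_⟩
  · rw [← Submodule.map_comp, LinearMap.fst_prod, Submodule.map_id]
  · rw [← Submodule.map_comp, LinearMap.snd_prod]
  · rintro _ ⟨y, hy, rfl⟩
    exact hS y hy

theorem isoWithin_refl (Y : Submodule 𝕜 X) : IsoWithin 1 Y Y := by
  simpa using isoWithin_of_linearMap (L := 1) LinearMap.id Y (by simp)

/-- The lower bound makes preimages of a convergent sequence Cauchy. Applied to the two coordinate
projections of a graph, it lets `IsoWithin` pass to closures with the same constant. -/
theorem topologicalClosure_map_le_of_bound {E F : Type*} [NormedAddCommGroup E] [NormedSpace 𝕜 E]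
    [CompleteSpace E] [NormedAddCommGroup F] [NormedSpace 𝕜 F] (f : E →L[𝕜] F)
    (Γ : Submodule 𝕜 E) (C : ℝ) (hC : ∀ p ∈ Γ, ‖p‖ ≤ C * ‖f p‖) :
    (Γ.map (f : E →ₗ[𝕜] F)).topologicalClosure ≤ Γ.topologicalClosure.map (f : E →ₗ[𝕜] F) := by
  intro y hy
  obtain ⟨u, hu, huy⟩ := mem_closure_iff_seq_limit.1 hy
  choose p hp hpu using hu
  have hpc : CauchySeq p := by
    rw [cauchySeq_iff_tendsto_dist_atTop_0]
    have := (cauchySeq_iff_tendsto_dist_atTop_0.1 huy.cauchySeq).const_mul C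
    rw [mul_zero] at this
    refine squeeze_zero (fun _ => dist_nonneg) (fun n => ?_) this
    rw [dist_eq_norm, dist_eq_norm, ← hpu, ← hpu]
    simpa using hC _ (Γ.sub_mem (hp n.1) (hp n.2))
  obtain ⟨q, hq⟩ := cauchySeq_tendsto_of_complete hpc
  refine ⟨q, mem_closure_of_tendsto hq (Eventually.of_forall hp), ?_⟩
  refine tendsto_nhds_unique ((f.continuous.tendsto q).comp hq) ?_
  exact huy.congr fun n => (hpu n).symm

theorem IsoWithin.topologicalClosure [CompleteSpace X] {L : ℝ} {Y Z : Submodule 𝕜 X}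
    (h : IsoWithin L Y Z) : IsoWithin L Y.topologicalClosure Z.topologicalClosure := by
  obtain ⟨Γ, rfl, rfl, hΓ⟩ := h
  refine ⟨Γ.topologicalClosure, le_antisymm ?_ ?_, le_antisymm ?_ ?_, ?_⟩
  · exact Submodule.map_le_iff_le_comap.2 (Γ.topologicalClosure_minimal
      (Submodule.map_le_iff_le_comap.1 (Submodule.le_topologicalClosure _))
      ((Submodule.isClosed_topologicalClosure _).preimage continuous_fst))
  · refine topologicalClosure_map_le_of_bound (ContinuousLinearMap.fst 𝕜 X X) Γ (max 1 L)
      fun p hp => ?_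
    rw [Prod.norm_def]
    refine max_le ?_ ((hΓ p hp).2.trans ?_)
    · exact le_mul_of_one_le_left (norm_nonneg _) (le_max_left _ _)
    · exact mul_le_mul_of_nonneg_right (le_max_right _ _) (norm_nonneg _)
  · exact Submodule.map_le_iff_le_comap.2 (Γ.topologicalClosure_minimal
      (Submodule.map_le_iff_le_comap.1 (Submodule.le_topologicalClosure _))
      ((Submodule.isClosed_topologicalClosure _).preimage continuous_snd))
  · refine topologicalClosure_map_le_of_bound (ContinuousLinearMap.snd 𝕜 X X) Γ (max 1 L)
      fun p hp => ?_
    rw [Prod.norm_def]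
    refine max_le ((hΓ p hp).1.trans ?_) ?_
    · exact mul_le_mul_of_nonneg_right (le_max_right _ _) (norm_nonneg _)
    · exact le_mul_of_one_le_left (norm_nonneg _) (le_max_left _ _)
  · refine closure_minimal (s := (Γ : Set (X × X)))
      (t := {p | ‖p.1‖ ≤ L * ‖p.2‖ ∧ ‖p.2‖ ≤ L * ‖p.1‖}) hΓ ?_
    have c1 : Continuous fun p : X × X => ‖p.1‖ := by fun_prop
    have c2 : Continuous fun p : X × X => ‖p.2‖ := by fun_prop
    exact (isClosed_le c1 (continuous_const.mul c2)).inter (isClosed_le c2 (continuous_const.mul c1))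

theorem IsoWithin.isKIsomorphic {L : ℝ} (hL : 0 ≤ L) {Y Z : ClosedSubmodule 𝕜 X}
    (h : IsoWithin L Y.toSubmodule Z.toSubmodule) : IsKIsomorphic (L * L) Y Z := by
  obtain ⟨Γ, h1, h2, hΓ⟩ := h
  have b1 : Function.Bijective ((LinearMap.fst 𝕜 X X).submoduleMap Γ) := by
    refine ⟨(injective_iff_map_eq_zero _).2 ?_, LinearMap.submoduleMap_surjective _ _⟩
    rintro ⟨⟨x, y⟩, hp⟩ h0
    have hx : x = 0 := congrArg Subtype.val h0
    have := (hΓ _ hp).2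
    simp only [hx, norm_zero, mul_zero, norm_le_zero_iff] at this
    simp [hx, this]
  have b2 : Function.Bijective ((LinearMap.snd 𝕜 X X).submoduleMap Γ) := by
    refine ⟨(injective_iff_map_eq_zero _).2 ?_, LinearMap.submoduleMap_surjective _ _⟩
    rintro ⟨⟨x, y⟩, hp⟩ h0
    have hx : y = 0 := congrArg Subtype.val h0
    have := (hΓ _ hp).1
    simp only [hx, norm_zero, mul_zero, norm_le_zero_iff] at this
    simp [hx, this]
  let e1 := (LinearEquiv.ofBijective _ b1).trans (LinearEquiv.ofEq _ _ h1)
  let e2 := (LinearEquiv.ofBijective _ b2).trans (LinearEquiv.ofEq _ _ h2)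
  have hto : ∀ y : Y.toSubmodule, ‖(e1.symm.trans e2) y‖ ≤ L * ‖y‖ := by
    intro y
    obtain ⟨p, rfl⟩ := e1.surjective y
    rw [LinearEquiv.trans_apply, LinearEquiv.symm_apply_apply]
    exact (hΓ _ p.2).2
  have hinv : ∀ z : Z.toSubmodule, ‖(e1.symm.trans e2).symm z‖ ≤ L * ‖z‖ := by
    intro z
    obtain ⟨p, rfl⟩ := e2.surjective z
    rw [LinearEquiv.symm_trans_apply, LinearEquiv.symm_apply_apply, LinearEquiv.symm_symm]
    exact (hΓ _ p.2).1
  refine ⟨(e1.symm.trans e2).toContinuousLinearEquivOfBounds L L hto hinv, ?_⟩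
  gcongr
  · exact ContinuousLinearMap.opNorm_le_bound _ hL hto
  · exact ContinuousLinearMap.opNorm_le_bound _ hL hinv

theorem IsoWithin.isomorphic {L : ℝ} {Y Z : ClosedSubmodule 𝕜 X}
    (h : IsoWithin L Y.toSubmodule Z.toSubmodule) : Isomorphic Y Z := by
  obtain ⟨T, -⟩ := (h.mono (le_max_left L 0)).isKIsomorphic (le_max_right L 0)
  exact ⟨T⟩

theorem Isomorphic.exists_isoWithin {Y Z : ClosedSubmodule 𝕜 X} (h : Isomorphic Y Z) :
    ∃ n : ℕ, IsoWithin (n : ℝ) Y.toSubmodule Z.toSubmodule := by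
  obtain ⟨T⟩ := h
  obtain ⟨n, hn⟩ := exists_nat_ge (max ‖(T : Y.toSubmodule →L[𝕜] Z.toSubmodule)‖
    ‖(T.symm : Z.toSubmodule →L[𝕜] Y.toSubmodule)‖)
  refine ⟨n, LinearMap.range (Y.toSubmodule.subtype.prod (Z.toSubmodule.subtype ∘ₗ
    (T.toLinearEquiv : Y.toSubmodule →ₗ[𝕜] Z.toSubmodule))), ?_, ?_, ?_⟩
  · rw [← LinearMap.range_comp, LinearMap.fst_prod, Submodule.range_subtype]
  · rw [← LinearMap.range_comp, LinearMap.snd_prod, LinearMap.range_comp, LinearEquiv.range,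
      Submodule.map_top, Submodule.range_subtype]
  · rintro _ ⟨y, rfl⟩
    constructor
    · have h := (T.symm : Z.toSubmodule →L[𝕜] Y.toSubmodule).le_of_opNorm_le
        ((le_max_right _ _).trans hn) (T y)
      simpa using h
    · exact (T : Y.toSubmodule →L[𝕜] Z.toSubmodule).le_of_opNorm_le
        ((le_max_left _ _).trans hn) y

/-- Riesz's lemma inside B ⊔ 𝕜 ∙ x. Replacing x by u makes the constants of one-dimensional
extensions independent of the position of x. -/
theorem exists_unit_sup_span_eq {B : Submodule 𝕜 X} (hB : IsClosed (B : Set X)) {x : X}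
    (hx : x ∉ B) : ∃ u : X, ‖u‖ = 1 ∧ B ⊔ 𝕜 ∙ u = B ⊔ 𝕜 ∙ x ∧ ∀ y ∈ B, 1 / 2 ≤ ‖u - y‖ := by
  let E := B ⊔ 𝕜 ∙ x
  have hxE : x ∈ E := Submodule.mem_sup_right (Submodule.mem_span_singleton_self x)
  obtain ⟨⟨u, huE⟩, huB, hu1, hu⟩ := riesz_lemma_of_lt_one (𝕜 := 𝕜) (F := B.comap E.subtype)
    (hB.preimage continuous_subtype_val) ⟨⟨x, hxE⟩, hx⟩ (r := 1 / 2) (by norm_num)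
  refine ⟨u, hu1, le_antisymm ?_ ?_, fun y hy => hu ⟨y, Submodule.mem_sup_left hy⟩ hy⟩
  · refine sup_le le_sup_left ?_
    rwa [Submodule.span_singleton_le_iff_mem]
  · refine sup_le le_sup_left ?_
    rw [Submodule.span_singleton_le_iff_mem]
    obtain ⟨b, hb, v, hv, hbv⟩ := Submodule.mem_sup.1 huE
    obtain ⟨c, rfl⟩ := Submodule.mem_span_singleton.1 hv
    have hc : c ≠ 0 := by
      rintro rfl
      apply huB
      rw [zero_smul, add_zero] at hbv
      exact hbv ▸ hb
    have : x = c⁻¹ • (u - b) := by rw [← hbv, add_sub_cancel_left, inv_smul_smul₀ hc]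
    rw [this]
    exact Submodule.smul_mem _ _ (Submodule.sub_mem _
      (Submodule.mem_sup_right (Submodule.mem_span_singleton_self u)) (Submodule.mem_sup_left hb))

theorem norm_coeff_le_of_dist {B : Submodule 𝕜 X} {u : X} (hu : ∀ y ∈ B, 1 / 2 ≤ ‖u - y‖)
    {y : X} (hy : y ∈ B) (c : 𝕜) : ‖c‖ ≤ 2 * ‖y + c • u‖ := by
  by_cases hc : c = 0
  · simp [hc]
  have h1 := hu (-(c⁻¹ • y)) (B.neg_mem (B.smul_mem _ hy))
  have h2 : y + c • u = c • (u - -(c⁻¹ • y)) := by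
    rw [sub_neg_eq_add, smul_add, smul_inv_smul₀ hc, add_comm]
  rw [h2, norm_smul]
  nlinarith [norm_nonneg c]

/-- Send one Riesz vector to the other. A coefficient has norm at most twice that of the whole
vector, which gives the bound 3 * L + 2 ≤ 5 * L. -/
theorem IsoWithin.sup_span {L : ℝ} (hL : 1 ≤ L) {Y Z : Submodule 𝕜 X} (h : IsoWithin L Y Z)
    (hY : IsClosed (Y : Set X)) (hZ : IsClosed (Z : Set X)) {x z : X} (hx : x ∉ Y) (hz : z ∉ Z) :
    IsoWithin (5 * L) (Y ⊔ 𝕜 ∙ x) (Z ⊔ 𝕜 ∙ z) := by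
  obtain ⟨u, hu1, hux, hu⟩ := exists_unit_sup_span_eq hY hx
  obtain ⟨w, hw1, hwz, hw⟩ := exists_unit_sup_span_eq hZ hz
  rw [← hux, ← hwz]
  obtain ⟨Γ, rfl, rfl, hΓ⟩ := h
  refine ⟨Γ ⊔ 𝕜 ∙ (u, w), ?_, ?_, ?_⟩
  · rw [Submodule.map_sup, Submodule.map_span, image_singleton]; rfl
  · rw [Submodule.map_sup, Submodule.map_span, image_singleton]; rfl
  · intro p hp
    obtain ⟨⟨a, b⟩, hab, v, hv, rfl⟩ := Submodule.mem_sup.1 hp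
    obtain ⟨c, rfl⟩ := Submodule.mem_span_singleton.1 hv
    have ha := norm_coeff_le_of_dist hu ⟨_, hab, rfl⟩ c
    have hb := norm_coeff_le_of_dist hw ⟨_, hab, rfl⟩ c
    simp only [Prod.smul_mk, Prod.mk_add_mk, LinearMap.fst_apply, LinearMap.snd_apply] at ha hb ⊢
    obtain ⟨h1, h2⟩ := hΓ _ hab
    simp only at h1 h2
    have hcu : ‖c • u‖ = ‖c‖ := by rw [norm_smul, hu1, mul_one]
    have hcw : ‖c • w‖ = ‖c‖ := by rw [norm_smul, hw1, mul_one]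
    have ha' : ‖a‖ ≤ ‖a + c • u‖ + ‖c‖ := by
      have := norm_sub_le (a + c • u) (c • u); rwa [add_sub_cancel_right, hcu] at this
    have hb' : ‖b‖ ≤ ‖b + c • w‖ + ‖c‖ := by
      have := norm_sub_le (b + c • w) (c • w); rwa [add_sub_cancel_right, hcw] at this
    have ta := norm_add_le a (c • u)
    have tb := norm_add_le b (c • w)
    rw [hcu] at ta
    rw [hcw] at tb
    have na := norm_nonneg (a + c • u)
    have nb := norm_nonneg (b + c • w)
    constructor <;> nlinarith

theorem exists_sup_span_eq_of_finrank_succ {A : Submodule 𝕜 X} {n : ℕ}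
    [FiniteDimensional 𝕜 A] (hA : Module.finrank 𝕜 A = n + 1) :
    ∃ (A' : Submodule 𝕜 X) (x : X), FiniteDimensional 𝕜 A' ∧ Module.finrank 𝕜 A' = n ∧ x ∉ A' ∧
      A' ⊔ 𝕜 ∙ x = A := by
  let b := Module.finBasisOfFinrankEq 𝕜 A hA
  have hli : LinearIndependent 𝕜 fun i => (b i : X) :=
    b.linearIndependent.map' A.subtype (Submodule.ker_subtype A)
  refine ⟨Submodule.span 𝕜 (range fun i : Fin n => (b i.castSucc : X)), b (Fin.last n),
    FiniteDimensional.span_of_finite 𝕜 (finite_range _), ?_, ?_, ?_⟩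
  · have := finrank_span_eq_card (hli.comp _ (Fin.castSucc_injective n))
    rwa [Fintype.card_fin] at this
  · have := hli.notMem_span_image (s := range Fin.castSucc) (x := Fin.last n)
      (by rintro ⟨i, hi⟩; exact Fin.castSucc_ne_last i hi)
    rwa [← range_comp] at this
  · have : A = Submodule.span 𝕜 (range fun i => (b i : X)) := by
      have := congrArg (Submodule.map A.subtype) b.span_eq
      rw [Submodule.map_span, Submodule.map_top, Submodule.range_subtype, ← range_comp] at this
      exact this.symm
    rw [← Submodule.span_union]
    conv_rhs => rw [this]
    congr 1
    ext y
    constructor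
    · rintro (⟨i, rfl⟩ | rfl)
      · exact ⟨_, rfl⟩
      · exact ⟨_, rfl⟩
    · rintro ⟨i, rfl⟩
      induction i using Fin.lastCases with
      | last => exact Or.inr rfl
      | cast i => exact Or.inl ⟨i, rfl⟩

theorem exists_le_finrank_eq {A : Submodule 𝕜 X} [FiniteDimensional 𝕜 A] {m : ℕ}
    (hm : m ≤ Module.finrank 𝕜 A) : ∃ A' ≤ A, Module.finrank 𝕜 A' = m := by
  induction hn : Module.finrank 𝕜 A generalizing A with
  | zero => exact ⟨A, le_rfl, by omega⟩
  | succ n ih =>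
    by_cases h : m = n + 1
    · exact ⟨A, le_rfl, by omega⟩
    obtain ⟨A', x, hf, hA', -, hs⟩ := exists_sup_span_eq_of_finrank_succ hn
    obtain ⟨A'', h1, h2⟩ := ih (A := A') (by omega) hA'
    exact ⟨A'', h1.trans (hs ▸ le_sup_left), h2⟩

theorem notMem_sup_of_disjoint {B A A' : Submodule 𝕜 X} {x : X} (hA : A' ⊔ 𝕜 ∙ x = A) (hx : x ∉ A')
    (hd : Disjoint B A) : x ∉ B ⊔ A' := by
  intro h
  obtain ⟨b, hb, a, ha, rfl⟩ := Submodule.mem_sup.1 h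
  have h1 : b ∈ A := by
    have h2 : b + a ∈ A := hA ▸ Submodule.mem_sup_right (Submodule.mem_span_singleton_self _)
    have h3 : a ∈ A := hA ▸ Submodule.mem_sup_left ha
    simpa using A.sub_mem h2 h3
  have : b = 0 := Submodule.disjoint_def.1 hd b hb h1
  rw [this, zero_add] at hx
  exact hx ha

/-- One dimension at a time, each costing a factor 5. What matters is that the constant depends only
on n, not on B, A or V. -/
theorem isoWithin_sup_of_finrank_eq {B : Submodule 𝕜 X} (hB : IsClosed (B : Set X)) {n : ℕ}
    {A V : Submodule 𝕜 X} [FiniteDimensional 𝕜 A] [FiniteDimensional 𝕜 V]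
    (hA : Module.finrank 𝕜 A = n) (hV : Module.finrank 𝕜 V = n) (hBA : Disjoint B A)
    (hBV : Disjoint B V) : IsoWithin (5 ^ n) (B ⊔ A) (B ⊔ V) := by
  induction n generalizing A V with
  | zero =>
    rw [Submodule.finrank_eq_zero] at hA hV
    subst hA hV
    simpa using isoWithin_refl B
  | succ n ih =>
    obtain ⟨A', x, _, hA', hx, hAx⟩ := exists_sup_span_eq_of_finrank_succ hA
    obtain ⟨V', z, _, hV', hz, hVz⟩ := exists_sup_span_eq_of_finrank_succ hV
    have h1 : A' ≤ A := hAx ▸ le_sup_left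
    have h2 : V' ≤ V := hVz ▸ le_sup_left
    have := (ih hA' hV' (hBA.mono_right h1) (hBV.mono_right h2)).sup_span (one_le_pow₀ (by norm_num))
      (B.isClosed_sup_finiteDimensional A' hB) (B.isClosed_sup_finiteDimensional V' hB)
      (notMem_sup_of_disjoint hAx hx hBA) (notMem_sup_of_disjoint hVz hz hBV)
    rwa [sup_assoc, sup_assoc, hAx, hVz, ← pow_succ'] at this

end IsoWithin

end ErgodicBanach

namespace ErgodicBanach

/-! ### Subspaces supported on intervals, and finite nets of them. -/

section Supported

variable {𝕜 : Type*} [RCLike 𝕜] {X : Type*} [NormedAddCommGroup X] [NormedSpace 𝕜 X]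
  (e : SchauderBasis 𝕜 X)

/-- The closed subspace of the vectors with support in `J`. -/
def supported (J : Set ℕ) : Submodule 𝕜 X where
  carrier := {x | ∀ i ∉ J, e.coord i x = 0}
  add_mem' hx hy i hi := by rw [map_add, hx i hi, hy i hi, add_zero]
  zero_mem' i _ := map_zero _
  smul_mem' c x hx i hi := by rw [map_smul, hx i hi, smul_zero]

theorem mem_supported {J : Set ℕ} {x : X} : x ∈ supported e J ↔ ∀ i ∉ J, e.coord i x = 0 := Iff.rfl

theorem supported_mono {J K : Set ℕ} (h : J ⊆ K) : supported e J ≤ supported e K :=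
  fun _ hx i hi => hx i fun h' => hi (h h')

theorem isClosed_supported (J : Set ℕ) : IsClosed (supported e J : Set X) := by
  have : (supported e J : Set X) = ⋂ i ∈ Jᶜ, {x | e.coord i x = 0} := by
    ext x; simp [mem_supported]
  rw [this]
  exact isClosed_biInter fun i _ => isClosed_eq (e.coord i).continuous continuous_const

theorem eq_zero_of_coord_eq_zero {x : X} (h : ∀ i, e.coord i x = 0) : x = 0 := by
  refine tendsto_nhds_unique (SchauderBasis.tendsto_proj e x) ?_
  simp [h]

theorem disjoint_supported {J K : Set ℕ} (h : Disjoint J K) :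
    Disjoint (supported e J) (supported e K) := by
  rw [Submodule.disjoint_def]
  intro x hx hy
  refine eq_zero_of_coord_eq_zero e fun i => ?_
  by_cases hi : i ∈ J
  · exact hy i fun hi' => disjoint_left.1 h hi hi'
  · exact hx i hi

theorem coord_basis (i j : ℕ) : e.coord i (e j) = if i = j then 1 else 0 := by
  rw [e.ortho]
  simp [Pi.single_apply]

theorem basis_mem_supported {J : Set ℕ} {i : ℕ} (hi : i ∈ J) : e i ∈ supported e J := by
  intro j hj
  rw [coord_basis, if_neg]
  rintro rfl
  exact hj hi

theorem proj_eq_self_of_mem_supported {A : Finset ℕ} {x : X} (hx : x ∈ supported e A) :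
    GeneralSchauderBasis.proj e A x = x := by
  rw [← sub_eq_zero]
  refine eq_zero_of_coord_eq_zero e fun i => ?_
  rw [map_sub, GeneralSchauderBasis.proj_apply, map_sum]
  simp only [map_smul, coord_basis, smul_eq_mul, mul_ite, mul_one, mul_zero, Finset.sum_ite_eq]
  split_ifs with h
  · exact sub_self _
  · rw [hx i (by simpa using h), sub_zero]

theorem supported_eq_range (A : Finset ℕ) :
    supported e A = LinearMap.range (GeneralSchauderBasis.proj e A).toLinearMap := by
  refine le_antisymm (fun x hx => ⟨x, proj_eq_self_of_mem_supported e hx⟩) ?_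
  rintro _ ⟨x, rfl⟩
  rw [ContinuousLinearMap.coe_coe, GeneralSchauderBasis.proj_apply]
  exact Submodule.sum_mem _ fun i hi => Submodule.smul_mem _ _ (basis_mem_supported e hi)

theorem finiteDimensional_supported {J : Set ℕ} (hJ : J.Finite) :
    FiniteDimensional 𝕜 (supported e J) := by
  lift J to Finset ℕ using hJ
  rw [supported_eq_range, GeneralSchauderBasis.range_proj_eq_span]
  exact FiniteDimensional.span_of_finite 𝕜 (J.finite_toSet.image _)

theorem finrank_supported_Ico (a b : ℕ) : Module.finrank 𝕜 (supported e (Ico a b)) = b - a := by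
  rw [← Finset.coe_Ico, supported_eq_range, GeneralSchauderBasis.finrank_range_proj, Nat.card_Ico]

/-- Vanishing of the first N coordinates imposes N linear conditions. -/
theorem finrank_le_finrank_inf_supported (U : Submodule 𝕜 X) [FiniteDimensional 𝕜 U] (N : ℕ) :
    Module.finrank 𝕜 U ≤ Module.finrank 𝕜 (U ⊓ supported e (Ici N) : Submodule 𝕜 X) + N := by
  let f : U →ₗ[𝕜] (Fin N → 𝕜) := LinearMap.pi fun i => (e.coord i).toLinearMap ∘ₗ U.subtype
  have h1 := LinearMap.finrank_range_add_finrank_ker f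
  have h2 : Module.finrank 𝕜 (LinearMap.range f) ≤ N := by
    simpa using (LinearMap.range f).finrank_le
  have h3 : (LinearMap.ker f).map U.subtype ≤ U ⊓ supported e (Ici N) := by
    rintro _ ⟨u, hu, rfl⟩
    refine ⟨u.2, fun i hi => ?_⟩
    exact congrFun hu ⟨i, by simpa using hi⟩
  have h4 := Submodule.finrank_mono h3
  rw [Submodule.finrank_map_subtype_eq] at h4
  omega

variable (𝕜) in
theorem exists_finite_net_orthonormal {m : ℕ} (d : ℕ) {δ : ℝ} (hδ : 0 < δ) :
    ∃ t : Set (Fin d → EuclideanSpace 𝕜 (Fin m)), t.Finite ∧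
      ∀ v : Fin d → EuclideanSpace 𝕜 (Fin m), Orthonormal 𝕜 v → ∃ w ∈ t, ∀ i, ‖w i - v i‖ ≤ δ := by
  have hb : Bornology.IsBounded {v : Fin d → EuclideanSpace 𝕜 (Fin m) | Orthonormal 𝕜 v} := by
    refine (Metric.isBounded_closedBall (x := 0) (r := 1)).subset fun v hv => ?_
    rw [mem_closedBall_zero_iff, pi_norm_le_iff_of_nonneg zero_le_one]
    exact fun i => (hv.1 i).le
  obtain ⟨t, -, htf, ht⟩ := Metric.finite_approx_of_totallyBounded
    (hb.isCompact_closure.totallyBounded.subset subset_closure) δ hδ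
  refine ⟨t, htf, fun v hv => ?_⟩
  obtain ⟨w, hw, hvw⟩ := mem_iUnion₂.1 (ht hv)
  refine ⟨w, hw, fun i => ?_⟩
  rw [← dist_eq_norm, dist_comm]
  exact (dist_le_pi_dist v w i).trans (Metric.mem_ball.1 hvw).le

/-- Transport to Euclidean space by the coordinates, where orthonormal families of each size have a
finite net. Moving an orthonormal basis of Y to a nearby net element is the effect of a small
operator that lives on the interval. -/
theorem exists_finite_net (a b : ℕ) {ε : ℝ} (hε : 0 < ε) :
    ∃ 𝒩 : Set (Submodule 𝕜 X), 𝒩.Finite ∧ (∀ Z ∈ 𝒩, Z ≤ supported e (Ico a b)) ∧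
      ∀ Y ≤ supported e (Ico a b), ∃ T : X →L[𝕜] X, ‖T‖ ≤ ε ∧
        (∀ x ∈ supported e (Ico a b)ᶜ, T x = 0) ∧ Y.map (LinearMap.id + T.toLinearMap) ∈ 𝒩 := by
  set m := b - a
  let Φ : EuclideanSpace 𝕜 (Fin m) →L[𝕜] X :=
    ∑ i : Fin m, (EuclideanSpace.proj i).smulRight (e (a + i))
  let Ψ : X →L[𝕜] EuclideanSpace 𝕜 (Fin m) :=
    ∑ i : Fin m, (e.coord (a + i)).smulRight (EuclideanSpace.single i 1)
  have hΦ : ∀ c, Φ c = ∑ i : Fin m, c i • e (a + i) := fun c => by simp [Φ]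
  have hΨ : ∀ x i, Ψ x i = e.coord (a + i) x := fun x i => by
    simp [Ψ, Finset.sum_apply, Pi.single_apply]
  have hΨΦ : ∀ c, Ψ (Φ c) = c := by
    intro c
    ext i
    rw [hΨ, hΦ, map_sum]
    simp [coord_basis, Fin.val_inj]
  have hΦmem : ∀ c, Φ c ∈ supported e (Ico a b) := by
    intro c
    rw [hΦ]
    refine Submodule.sum_mem _ fun i _ => Submodule.smul_mem _ _ (basis_mem_supported e ?_)
    have := i.2
    exact ⟨by omega, by omega⟩
  have hΦΨ : ∀ x ∈ supported e (Ico a b), Φ (Ψ x) = x := by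
    intro x hx
    rw [← sub_eq_zero]
    refine eq_zero_of_coord_eq_zero e fun i => ?_
    rw [map_sub]
    by_cases hi : i ∈ Ico a b
    · have hi' : i = a + (⟨i - a, by simp at hi; omega⟩ : Fin m) := by simp at hi ⊢; omega
      rw [hi', ← hΨ, ← hΨ, hΨΦ, sub_self]
    · rw [hx i hi, hΦmem _ i hi, sub_zero]
  have hδ : 0 < ε / (m * (‖Ψ‖ * ‖Φ‖) + 1) := by positivity
  choose t htf ht using fun d => exists_finite_net_orthonormal 𝕜 (m := m) d hδ
  refine ⟨⋃ d ∈ Finset.range (m + 1), (fun w => Submodule.span 𝕜 (range fun i => Φ (w i))) '' t d,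
    ?_, ?_, ?_⟩
  · exact Finite.biUnion (Finset.finite_toSet _) fun d _ => (htf d).image _
  · intro Z hZ
    simp only [mem_iUnion, mem_image] at hZ
    obtain ⟨d, -, w, -, rfl⟩ := hZ
    rw [Submodule.span_le]
    rintro _ ⟨i, rfl⟩
    exact hΦmem _
  · intro Y hY
    let Y' := Y.comap Φ.toLinearMap
    set d := Module.finrank 𝕜 Y'
    have hd : d ≤ m := by simpa using Y'.finrank_le
    let v : Fin d → EuclideanSpace 𝕜 (Fin m) := fun i => stdOrthonormalBasis 𝕜 Y' i
    have hv : Orthonormal 𝕜 v :=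
      (stdOrthonormalBasis 𝕜 Y').orthonormal.comp_linearIsometry Y'.subtypeₗᵢ
    obtain ⟨w, hw, hvw⟩ := ht d v hv
    have hYspan : Y = Submodule.span 𝕜 (range fun i => Φ (v i)) := by
      apply le_antisymm
      · intro y hy
        have hy' : Ψ y ∈ Y' := by
          change Φ (Ψ y) ∈ Y
          rwa [hΦΨ y (hY hy)]
        have h1 := (stdOrthonormalBasis 𝕜 Y').sum_repr ⟨Ψ y, hy'⟩
        have h2 := congrArg (fun z : Y' => Φ z) h1
        simp only [Submodule.coe_sum, Submodule.coe_smul, map_sum, map_smul, hΦΨ y (hY hy)] at h2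
        rw [← h2]
        exact Submodule.sum_mem _ fun i _ => Submodule.smul_mem _ _
          (Submodule.subset_span ⟨i, rfl⟩)
      · rw [Submodule.span_le]
        rintro _ ⟨i, rfl⟩
        exact (stdOrthonormalBasis 𝕜 Y' i).2
    -- By orthonormality, the identity plus T sends each `Φ (v i)` to `Φ (w i)`.
    let T : X →L[𝕜] X := ∑ i, ((innerSL 𝕜 (v i)).comp Ψ).smulRight (Φ (w i - v i))
    have hT : ∀ x, T x = ∑ i, inner 𝕜 (v i) (Ψ x) • Φ (w i - v i) := fun x => by simp [T]
    refine ⟨T, ?_, ?_, ?_⟩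
    · calc ‖T‖ ≤ ∑ _i : Fin d, ‖Ψ‖ * (‖Φ‖ * (ε / (m * (‖Ψ‖ * ‖Φ‖) + 1))) := by
            refine norm_sum_le_of_le _ fun i _ => ?_
            rw [ContinuousLinearMap.norm_smulRight_apply]
            gcongr
            · refine ((innerSL 𝕜 (v i)).opNorm_comp_le Ψ).trans ?_
              rw [innerSL_apply_norm, hv.1 i, one_mul]
            · exact (Φ.le_opNorm _).trans (by gcongr; exact hvw i)
        _ = (d * (‖Ψ‖ * ‖Φ‖)) * (ε / (m * (‖Ψ‖ * ‖Φ‖) + 1)) := by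
            rw [Finset.sum_const, Finset.card_univ, Fintype.card_fin, nsmul_eq_mul]; ring
        _ ≤ (m * (‖Ψ‖ * ‖Φ‖) + 1) * (ε / (m * (‖Ψ‖ * ‖Φ‖) + 1)) := by
            gcongr
            have : (d : ℝ) ≤ m := by exact_mod_cast hd
            nlinarith [mul_nonneg (norm_nonneg Ψ) (norm_nonneg Φ)]
        _ = ε := by field_simp
    · intro x hx
      have : Ψ x = 0 := by
        ext i
        rw [hΨ]
        have := i.2
        exact hx _ fun h => h ⟨by omega, by omega⟩
      simp [hT, this]
    · simp only [mem_iUnion, mem_image]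
      refine ⟨d, by simp; omega, w, hw, ?_⟩
      conv_rhs => rw [hYspan]
      rw [Submodule.map_span, ← range_comp]
      congr 2
      ext i
      have hTv : T (Φ (v i)) = Φ (w i - v i) := by
        rw [hT, hΨΦ, Finset.sum_eq_single i]
        · rw [orthonormal_iff_ite.1 hv, if_pos rfl, one_smul]
        · intro j _ hj
          rw [orthonormal_iff_ite.1 hv, if_neg hj, zero_smul]
        · simp
      simp [hTv]

/-- A countable family of subspaces, each with an interval containing the supports of its
elements, finitely many on each bounded interval, that approximates every subspace on every
interval. -/
structure BlockNet where
  lo : ℕ → ℕ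
  hi : ℕ → ℕ
  sub : ℕ → Submodule 𝕜 X
  lo_lt_hi : ∀ l, lo l < hi l
  finite_hi_le : ∀ M, {l | hi l ≤ M}.Finite
  sub_le : ∀ l, sub l ≤ supported e (Ico (lo l) (hi l))
  full : ∀ a b, a < b → ∃ l, lo l = a ∧ hi l = b ∧ sub l = supported e (Ico a b)
  approx : ∀ a b, a < b → ∀ Y ≤ supported e (Ico a b), ∃ l, lo l = a ∧ hi l = b ∧
    ∃ T : X →L[𝕜] X, ‖T‖ ≤ (1 / 2) ^ (b + 2) ∧ (∀ x ∈ supported e (Ico a b)ᶜ, T x = 0) ∧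
      Y.map (LinearMap.id + T.toLinearMap) = sub l

theorem nonempty_blockNet : Nonempty (BlockNet e) := by
  choose 𝒩 hfin hle happ using fun a b : ℕ =>
    exists_finite_net e a b (ε := (1 / 2) ^ (b + 2)) (by positivity)
  let S : Set (ℕ × ℕ × Submodule 𝕜 X) :=
    {s | s.1 < s.2.1 ∧ s.2.2 ∈ insert (supported e (Ico s.1 s.2.1)) (𝒩 s.1 s.2.1)}
  have hSM : ∀ M, {s ∈ S | s.2.1 ≤ M}.Finite := by
    intro M
    refine Finite.subset (s := ⋃ a ∈ Finset.range (M + 1), ⋃ b ∈ Finset.range (M + 1),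
      (fun Z => (a, b, Z)) '' insert (supported e (Ico a b)) (𝒩 a b)) ?_ ?_
    · exact Finite.biUnion (Finset.finite_toSet _) fun a _ =>
        Finite.biUnion (Finset.finite_toSet _) fun b _ => ((hfin a b).insert _).image _
    · rintro ⟨a, b, Z⟩ ⟨⟨hab, hZ⟩, hb⟩
      simp only [mem_iUnion, Finset.mem_range, mem_image]
      simp only at hab hb
      exact ⟨a, by omega, b, by omega, Z, hZ, rfl⟩
  have hSc : S.Countable := by
    refine (countable_iUnion fun M => (hSM M).countable).mono fun s hs => ?_
    exact mem_iUnion.2 ⟨s.2.1, hs, le_rfl⟩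
  have hSi : S.Infinite := by
    refine infinite_of_injective_forall_mem
      (f := fun n => (n, n + 1, supported e (Ico n (n + 1)))) (fun m n h => (Prod.ext_iff.1 h).1) ?_
    exact fun n => ⟨Nat.lt_succ_self n, mem_insert _ _⟩
  have := hSc.to_subtype
  have := hSi.to_subtype
  -- The labelling must be without repetition for only finitely many labels to end before a given M.
  obtain ⟨g⟩ : Nonempty (ℕ ≃ S) := inferInstance
  have hmem : ∀ s (hs : s ∈ S), (g (g.symm ⟨s, hs⟩) : ℕ × ℕ × Submodule 𝕜 X) = s := fun s hs => by
    rw [Equiv.apply_symm_apply]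
  refine ⟨{ lo := fun l => (g l).1.1, hi := fun l => (g l).1.2.1, sub := fun l => (g l).1.2.2
            lo_lt_hi := fun l => (g l).2.1, finite_hi_le := fun M => ?_, sub_le := fun l => ?_
            full := fun a b hab => ?_, approx := fun a b hab Y hY => ?_ }⟩
  · refine ((hSM M).preimage (f := fun l => (g l).1) ?_).subset fun l hl => ⟨(g l).2, hl⟩
    exact (Subtype.val_injective.comp g.injective).injOn
  · obtain h | h := (g l).2.2
    · exact h.le
    · exact hle _ _ _ h
  · refine ⟨g.symm ⟨(a, b, supported e (Ico a b)), hab, mem_insert _ _⟩, ?_⟩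
    simp only [hmem]
    exact ⟨trivial, trivial, trivial⟩
  · obtain ⟨T, hT, hT0, hTY⟩ := happ a b Y hY
    refine ⟨g.symm ⟨(a, b, _), hab, mem_insert_of_mem _ hTY⟩, ?_⟩
    simp only [hmem]
    exact ⟨trivial, trivial, T, hT, hT0, rfl⟩

end Supported

end ErgodicBanach

namespace ErgodicBanach

/-! ### Analyticity of uniform isomorphism. -/

section Analytic

variable {𝕜 : Type*} [RCLike 𝕜] {X : Type*} [NormedAddCommGroup X] [NormedSpace 𝕜 X]

theorem secondCountableTopology_of_schauderBasis (e : SchauderBasis 𝕜 X) :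
    SecondCountableTopology X := by
  have hd : Dense (Submodule.span 𝕜 (range e) : Set X) := fun x =>
    mem_closure_of_tendsto (SchauderBasis.tendsto_proj e x) (Eventually.of_forall fun n => by
      rw [SchauderBasis.proj_apply]
      exact Submodule.sum_mem _ fun i _ => Submodule.smul_mem _ _ (Submodule.subset_span ⟨i, rfl⟩))
  have hs : TopologicalSpace.IsSeparable (Submodule.span 𝕜 (range e) : Set X) :=
    (countable_range e).isSeparable.span
  have : TopologicalSpace.SeparableSpace X := by
    rw [← TopologicalSpace.isSeparable_univ_iff, ← hd.closure_eq]
    exact hs.closure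
  exact UniformSpace.secondCountable_of_separable X

theorem exists_seq_span_eq (Y : Submodule 𝕜 X) [FiniteDimensional 𝕜 Y] :
    ∃ v : ℕ → X, Submodule.span 𝕜 (range v) = Y := by
  obtain ⟨S, hSf, hS⟩ := Submodule.fg_def.1 (Submodule.fg_iff_finiteDimensional Y |>.2 inferInstance)
  obtain ⟨v, hv⟩ := (hSf.insert 0).countable.exists_eq_range ⟨0, mem_insert _ _⟩
  exact ⟨v, by rw [← hv, Submodule.span_insert_zero, hS]⟩

/-- The linear combinations of those `w (l, j)` for which `x l` holds. -/
noncomputable def selectComb (x : ℕ → Bool) (w : ℕ × ℕ → X) : (ℕ × ℕ →₀ 𝕜) →ₗ[𝕜] X :=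
  Finsupp.linearCombination 𝕜 fun i => if x i.1 then w i else 0

theorem continuous_selectComb (c : ℕ × ℕ →₀ 𝕜) :
    Continuous fun z : (ℕ → Bool) × (ℕ × ℕ → X) => selectComb z.1 z.2 c := by
  have h : ∀ i : ℕ × ℕ, Continuous fun z : (ℕ → Bool) × (ℕ × ℕ → X) =>
      if z.1 i.1 then z.2 i else 0 := by
    intro i
    have h1 : Continuous fun b : Bool => if b then (1 : 𝕜) else 0 := continuous_of_discreteTopology
    have h2 : Continuous fun z : (ℕ → Bool) × (ℕ × ℕ → X) =>
        (if z.1 i.1 then (1 : 𝕜) else 0) • z.2 i :=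
      (h1.comp ((continuous_apply i.1).comp continuous_fst)).smul
        ((continuous_apply i).comp continuous_snd)
    simpa only [ite_smul, one_smul, zero_smul] using h2
  simp only [selectComb, Finsupp.linearCombination_apply, Finsupp.sum]
  exact continuous_finsetSum _ fun i _ => (h i).const_smul _

theorem selectComb_single {x : ℕ → Bool} (w : ℕ × ℕ → X) {i : ℕ × ℕ} (hi : x i.1 = true) :
    selectComb (𝕜 := 𝕜) x w (Finsupp.single i 1) = w i := by
  simp [selectComb, hi]

theorem range_selectComb_le {x : ℕ → Bool} {w : ℕ × ℕ → X} {Y : Submodule 𝕜 X}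
    (h : ∀ i : ℕ × ℕ, x i.1 = true → w i ∈ Y) : LinearMap.range (selectComb (𝕜 := 𝕜) x w) ≤ Y := by
  rw [selectComb, Finsupp.range_linearCombination, Submodule.span_le]
  rintro _ ⟨i, rfl⟩
  by_cases hi : x i.1 = true
  · simpa [hi] using h i hi
  · simp [hi]

theorem range_selectComb {x : ℕ → Bool} {v : ℕ × ℕ → X} {sub : ℕ → Submodule 𝕜 X}
    (hv : ∀ l, Submodule.span 𝕜 (range fun j => v (l, j)) = sub l) :
    LinearMap.range (selectComb (𝕜 := 𝕜) x v) = ⨆ l ∈ {l | x l = true}, sub l := by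
  refine le_antisymm (range_selectComb_le fun i hi => ?_) (iSup₂_le fun l hl => ?_)
  · refine Submodule.mem_iSup_of_mem i.1 (Submodule.mem_iSup_of_mem hi ?_)
    rw [← hv]
    exact Submodule.subset_span ⟨i.2, rfl⟩
  · rw [← hv, Submodule.span_le]
    rintro _ ⟨j, rfl⟩
    exact ⟨_, selectComb_single v (i := (l, j)) hl⟩

theorem mem_topologicalClosure_range {E : Type*} [AddCommGroup E] [Module 𝕜 E] (f : E →ₗ[𝕜] X)
    (y : X) : y ∈ (LinearMap.range f).topologicalClosure ↔
      ∀ n : ℕ, ∃ c, ‖y - f c‖ < 1 / ((n : ℝ) + 1) := by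
  rw [← SetLike.mem_coe, Submodule.topologicalClosure_coe, Metric.mem_closure_iff]
  constructor
  · intro h n
    obtain ⟨_, ⟨c, rfl⟩, hc⟩ := h _ Nat.one_div_pos_of_nat
    exact ⟨c, by rwa [← dist_eq_norm]⟩
  · intro h ε hε
    obtain ⟨n, hn⟩ := exists_nat_one_div_lt hε
    obtain ⟨c, hc⟩ := h n
    exact ⟨f c, ⟨c, rfl⟩, by rw [dist_eq_norm]; exact hc.trans hn⟩

/-- An isomorphism is recorded by the images w of the spanning vectors: the norm bounds make it
extend, and the two membership conditions say that its image has the right closed span. The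
isomorphism thus becomes a quantifier over a sequence of vectors. -/
theorem isoWithin_range_iff [CompleteSpace X] {L : ℝ} {v : ℕ × ℕ → X} {x y : ℕ → Bool} :
    IsoWithin L (LinearMap.range (selectComb (𝕜 := 𝕜) x v)).topologicalClosure
        (LinearMap.range (selectComb (𝕜 := 𝕜) y v)).topologicalClosure ↔
      ∃ w : ℕ × ℕ → X, (∀ c : ℕ × ℕ →₀ 𝕜, ‖selectComb x v c‖ ≤ L * ‖selectComb x w c‖ ∧
          ‖selectComb x w c‖ ≤ L * ‖selectComb x v c‖) ∧
        (∀ i : ℕ × ℕ, x i.1 = true → w i ∈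
          (LinearMap.range (selectComb (𝕜 := 𝕜) y v)).topologicalClosure) ∧
        ∀ i : ℕ × ℕ, y i.1 = true → v i ∈
          (LinearMap.range (selectComb (𝕜 := 𝕜) x w)).topologicalClosure := by
  constructor
  · rintro ⟨Γ, h1, h2, hΓ⟩
    have hex : ∀ i : ℕ × ℕ, ∃ u, x i.1 = true → (v i, u) ∈ Γ := by
      intro i
      by_cases hi : x i.1 = true
      · have : v i ∈ Γ.map (LinearMap.fst 𝕜 X X) := by
          rw [h1]
          exact Submodule.le_topologicalClosure _ ⟨_, selectComb_single v hi⟩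
        obtain ⟨⟨_, u⟩, hu, rfl⟩ := this
        exact ⟨u, fun _ => hu⟩
      · exact ⟨0, fun h => absurd h hi⟩
    choose w hw using hex
    have hmem : ∀ c : ℕ × ℕ →₀ 𝕜, (selectComb x v c, selectComb x w c) ∈ Γ := by
      intro c
      have : (selectComb x v c, selectComb x w c) =
          c.sum fun i a => a • (if x i.1 then v i else 0, if x i.1 then w i else 0) := by
        simp only [selectComb, Finsupp.linearCombination_apply, Finsupp.sum]
        ext
        · simp [Prod.fst_sum]
        · simp [Prod.snd_sum]
      rw [this]
      refine Submodule.sum_mem _ fun i _ => Submodule.smul_mem _ _ ?_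
      by_cases hi : x i.1 = true
      · simpa [hi] using hw i hi
      · rw [if_neg hi, if_neg hi]
        exact Γ.zero_mem
    refine ⟨w, fun c => hΓ _ (hmem c), fun i hi => ?_, fun i hi => ?_⟩
    · rw [← h2]
      exact ⟨_, hw i hi, rfl⟩
    · have : v i ∈ Γ.map (LinearMap.snd 𝕜 X X) := by
        rw [h2]
        exact Submodule.le_topologicalClosure _ ⟨_, selectComb_single v hi⟩
      obtain ⟨⟨p, q⟩, hpq, hq⟩ := this
      have hp : p ∈ (LinearMap.range (selectComb (𝕜 := 𝕜) x v)).topologicalClosure := by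
        rw [← h1]; exact ⟨_, hpq, rfl⟩
      change q = v i at hq
      rw [← hq, ← SetLike.mem_coe, Submodule.topologicalClosure_coe, Metric.mem_closure_iff]
      intro ε hε
      obtain ⟨_, ⟨c, rfl⟩, hc⟩ := Metric.mem_closure_iff.1 hp (ε / (|L| + 1)) (by positivity)
      refine ⟨_, ⟨c, rfl⟩, ?_⟩
      have := (hΓ _ (Γ.sub_mem hpq (hmem c))).2
      rw [dist_eq_norm] at hc ⊢
      calc ‖q - selectComb x w c‖ ≤ L * ‖p - selectComb x v c‖ := this
        _ ≤ (|L| + 1) * ‖p - selectComb x v c‖ := by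
            gcongr; linarith [le_abs_self L]
        _ < (|L| + 1) * (ε / (|L| + 1)) := by gcongr
        _ = ε := by field_simp
  · rintro ⟨w, hw1, hw2, hw3⟩
    have h : IsoWithin L (LinearMap.range (selectComb (𝕜 := 𝕜) x v))
        (LinearMap.range (selectComb (𝕜 := 𝕜) x w)) := by
      refine ⟨LinearMap.range ((selectComb x v).prod (selectComb x w)), ?_, ?_, ?_⟩
      · rw [← LinearMap.range_comp, LinearMap.fst_prod]
      · rw [← LinearMap.range_comp, LinearMap.snd_prod]
      · rintro _ ⟨c, rfl⟩
        exact hw1 c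
    have heq : (LinearMap.range (selectComb (𝕜 := 𝕜) x w)).topologicalClosure =
        (LinearMap.range (selectComb (𝕜 := 𝕜) y v)).topologicalClosure := by
      apply le_antisymm <;>
        refine Submodule.topologicalClosure_minimal _ (range_selectComb_le ?_)
          (Submodule.isClosed_topologicalClosure _)
      · exact hw2
      · exact hw3
    exact heq ▸ h.topologicalClosure

theorem analyticSet_isoWithin [CompleteSpace X] [SecondCountableTopology X] (L : ℝ)
    (sub : ℕ → Submodule 𝕜 X) [∀ l, FiniteDimensional 𝕜 (sub l)] :
    AnalyticSet {z : (ℕ → Bool) × (ℕ → Bool) |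
      IsoWithin L (⨆ l ∈ {l | z.1 l = true}, sub l).topologicalClosure
        (⨆ l ∈ {l | z.2 l = true}, sub l).topologicalClosure} := by
  choose v' hv' using fun l => exists_seq_span_eq (sub l)
  let v : ℕ × ℕ → X := fun i => v' i.1 i.2
  have hv : ∀ l, Submodule.span 𝕜 (range fun j => v (l, j)) = sub l := hv'
  let S1 : Set (((ℕ → Bool) × (ℕ → Bool)) × (ℕ × ℕ → X)) := {z | ∀ c : ℕ × ℕ →₀ 𝕜, ‖selectComb z.1.1 v c‖ ≤ L * ‖selectComb z.1.1 z.2 c‖ ∧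
      ‖selectComb z.1.1 z.2 c‖ ≤ L * ‖selectComb z.1.1 v c‖}
  let S2 : ℕ × ℕ → ℕ → Set (((ℕ → Bool) × (ℕ → Bool)) × (ℕ × ℕ → X)) := fun i n => {z | z.1.1 i.1 = true →
    ∃ c : ℕ × ℕ →₀ 𝕜, ‖z.2 i - selectComb z.1.2 v c‖ < 1 / ((n : ℝ) + 1)}
  let S3 : ℕ × ℕ → ℕ → Set (((ℕ → Bool) × (ℕ → Bool)) × (ℕ × ℕ → X)) := fun i n => {z | z.1.2 i.1 = true →
    ∃ c : ℕ × ℕ →₀ 𝕜, ‖v i - selectComb z.1.1 z.2 c‖ < 1 / ((n : ℝ) + 1)}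
  have c11 : ∀ c : ℕ × ℕ →₀ 𝕜, Continuous fun z : ((ℕ → Bool) × (ℕ → Bool)) × (ℕ × ℕ → X) => selectComb z.1.1 v c := fun c =>
    (continuous_selectComb c).comp
      (by fun_prop : Continuous fun z : ((ℕ → Bool) × (ℕ → Bool)) × (ℕ × ℕ → X) => ((z.1.1, v) : (ℕ → Bool) × (ℕ × ℕ → X)))
  have c12 : ∀ c : ℕ × ℕ →₀ 𝕜, Continuous fun z : ((ℕ → Bool) × (ℕ → Bool)) × (ℕ × ℕ → X) => selectComb z.1.2 v c := fun c =>
    (continuous_selectComb c).comp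
      (by fun_prop : Continuous fun z : ((ℕ → Bool) × (ℕ → Bool)) × (ℕ × ℕ → X) => ((z.1.2, v) : (ℕ → Bool) × (ℕ × ℕ → X)))
  have c2 : ∀ c : ℕ × ℕ →₀ 𝕜, Continuous fun z : ((ℕ → Bool) × (ℕ → Bool)) × (ℕ × ℕ → X) => selectComb z.1.1 z.2 c := fun c =>
    (continuous_selectComb c).comp
      (by fun_prop : Continuous fun z : ((ℕ → Bool) × (ℕ → Bool)) × (ℕ × ℕ → X) => ((z.1.1, z.2) : (ℕ → Bool) × (ℕ × ℕ → X)))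
  have hS1 : IsClosed S1 := by
    simp only [S1, ofPred_forall, ofPred_and]
    exact isClosed_iInter fun c => (isClosed_le (c11 c).norm ((c2 c).norm.const_mul L)).inter
      (isClosed_le (c2 c).norm ((c11 c).norm.const_mul L))
  have hS2 : ∀ i n, IsOpen (S2 i n) := by
    intro i n
    simp only [S2, imp_iff_not_or, ofPred_or, ofPred_exists]
    refine IsOpen.union ?_ (isOpen_iUnion fun c => isOpen_lt ?_ continuous_const)
    · exact (isOpen_discrete {b : Bool | ¬ b = true}).preimage
        (by fun_prop : Continuous fun z : ((ℕ → Bool) × (ℕ → Bool)) × (ℕ × ℕ → X) => z.1.1 i.1)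
    · exact ((by fun_prop : Continuous fun z : ((ℕ → Bool) × (ℕ → Bool)) × (ℕ × ℕ → X) => z.2 i).sub (c12 c)).norm
  have hS3 : ∀ i n, IsOpen (S3 i n) := by
    intro i n
    simp only [S3, imp_iff_not_or, ofPred_or, ofPred_exists]
    refine IsOpen.union ?_ (isOpen_iUnion fun c => isOpen_lt ?_ continuous_const)
    · exact (isOpen_discrete {b : Bool | ¬ b = true}).preimage
        (by fun_prop : Continuous fun z : ((ℕ → Bool) × (ℕ → Bool)) × (ℕ × ℕ → X) => z.1.2 i.1)
    · exact (continuous_const.sub (c2 c)).norm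
  -- The quantifiers over all finitely supported c are uncountable but harmless: the universal one
  -- yields a closed set, the existential ones open sets.
  have hS : AnalyticSet (S1 ∩ ((⋂ i, ⋂ n, S2 i n) ∩ ⋂ i, ⋂ n, S3 i n)) := by
    have : TopologicalSpace.IsCompletelyMetrizableSpace Bool := .discrete
    have : PolishSpace (ℕ → Bool) := {}
    borelize (((ℕ → Bool) × (ℕ → Bool)) × (ℕ × ℕ → X))
    refine MeasurableSet.analyticSet (hS1.measurableSet.inter (MeasurableSet.inter ?_ ?_))
    · exact MeasurableSet.iInter fun i => MeasurableSet.iInter fun n => (hS2 i n).measurableSet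
    · exact MeasurableSet.iInter fun i => MeasurableSet.iInter fun n => (hS3 i n).measurableSet
  convert hS.image_of_continuous continuous_fst using 1
  ext ⟨x, y⟩
  change IsoWithin L (⨆ l ∈ {l | x l = true}, sub l).topologicalClosure
    (⨆ l ∈ {l | y l = true}, sub l).topologicalClosure ↔ _
  rw [← range_selectComb hv, ← range_selectComb hv, isoWithin_range_iff]
  simp only [mem_topologicalClosure_range, mem_image, mem_inter_iff, mem_iInter]
  constructor
  · rintro ⟨w, h1, h2, h3⟩
    exact ⟨((x, y), w), ⟨h1, fun i n hi => h2 i hi n, fun i n hi => h3 i hi n⟩, rfl⟩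
  · rintro ⟨⟨⟨x', y'⟩, w⟩, ⟨h1, h2, h3⟩, h⟩
    obtain ⟨rfl, rfl⟩ := Prod.mk.inj h
    exact ⟨w, h1, fun i hi n => h2 i n hi, fun i hi n => h3 i n hi⟩

end Analytic

end ErgodicBanach

namespace ErgodicBanach

/-! ### The compact space of configurations, and finite blocks forcing membership in open sets. -/

namespace BlockNet

variable {𝕜 : Type*} [RCLike 𝕜] {X : Type*} [NormedAddCommGroup X] [NormedSpace 𝕜 X]
  {e : SchauderBasis 𝕜 X} (N : BlockNet e)

/-- The intervals of the labels in `S` are pairwise disjoint. -/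
def Separated (S : Set ℕ) : Prop :=
  ∀ l ∈ S, ∀ l' ∈ S, l ≠ l' → N.hi l ≤ N.lo l' ∨ N.hi l' ≤ N.lo l

/-- `S` is a set of labels with pairwise disjoint intervals in `[a, b)`, one of which ends
at `b`. -/
structure IsBlock (S : Set ℕ) (a b : ℕ) : Prop where
  separated : N.Separated S
  le_lo : ∀ l ∈ S, a ≤ N.lo l
  hi_le : ∀ l ∈ S, N.hi l ≤ b
  exists_hi_eq : ∃ l ∈ S, N.hi l = b

variable {N} in
theorem Separated.mono {S T : Set ℕ} (hT : N.Separated T) (h : S ⊆ T) : N.Separated S :=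
  fun l hl l' hl' => hT l (h hl) l' (h hl')

variable {N} in
theorem Separated.union {S T : Set ℕ} (hS : N.Separated S) (hT : N.Separated T) {b : ℕ}
    (hSb : ∀ l ∈ S, N.hi l ≤ b) (hTb : ∀ l ∈ T, b ≤ N.lo l) : N.Separated (S ∪ T) := by
  rintro l (hl | hl) l' (hl' | hl') hne
  · exact hS l hl l' hl' hne
  · exact Or.inl ((hSb l hl).trans (hTb l' hl'))
  · exact Or.inr ((hSb l' hl').trans (hTb l hl))
  · exact hT l hl l' hl' hne

theorem separated_singleton (l : ℕ) : N.Separated {l} := by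
  rintro _ rfl _ rfl h
  exact absurd rfl h

variable {N} in
theorem IsBlock.lt {S : Set ℕ} {a b : ℕ} (h : N.IsBlock S a b) : a < b := by
  obtain ⟨l, hl, rfl⟩ := h.exists_hi_eq
  exact (h.le_lo l hl).trans_lt (N.lo_lt_hi l)

variable {N} in
theorem IsBlock.union {S T : Set ℕ} {a b c : ℕ} (hS : N.IsBlock S a b) (hT : N.IsBlock T b c) :
    N.IsBlock (S ∪ T) a c where
  separated := hS.separated.union hT.separated hS.hi_le hT.le_lo
  le_lo l hl := hl.elim (hS.le_lo l) fun h => hS.lt.le.trans (hT.le_lo l h)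
  hi_le l hl := hl.elim (fun h => (hS.hi_le l h).trans hT.lt.le) (hT.hi_le l)
  exists_hi_eq := hT.exists_hi_eq.imp fun _ h => ⟨Or.inr h.1, h.2⟩

variable {N} in
theorem IsBlock.mono_left {S : Set ℕ} {a a' b : ℕ} (hS : N.IsBlock S a b) (h : a' ≤ a) :
    N.IsBlock S a' b :=
  ⟨hS.separated, fun l hl => h.trans (hS.le_lo l hl), hS.hi_le, hS.exists_hi_eq⟩

theorem exists_isBlock_full {a b : ℕ} (h : a < b) : ∃ l, N.lo l = a ∧ N.hi l = b ∧
    N.sub l = supported e (Ico a b) ∧ N.IsBlock {l} a b := by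
  obtain ⟨l, h1, h2, h3⟩ := N.full a b h
  refine ⟨l, h1, h2, h3, N.separated_singleton l, ?_, ?_, l, rfl, h2⟩
  · rintro _ rfl; exact h1.ge
  · rintro _ rfl; exact h2.le

/-- The space of all sets of labels with pairwise disjoint intervals. -/
def Space : Type := {x : ℕ → Bool // N.Separated {l | x l = true}}

instance : TopologicalSpace N.Space := instTopologicalSpaceSubtype

instance : SecondCountableTopology N.Space :=
  TopologicalSpace.Subtype.secondCountableTopology _

instance : T2Space N.Space := inferInstanceAs (T2Space {x : ℕ → Bool // N.Separated {l | x l = true}})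

theorem isClosed_separated : IsClosed {x : ℕ → Bool | N.Separated {l | x l = true}} := by
  simp only [Separated, ofPred_forall, mem_ofPred_eq]
  refine isClosed_iInter fun l => ?_
  have hc : ∀ l : ℕ, IsOpen {x : ℕ → Bool | x l = true} := fun l =>
    (isOpen_discrete {true}).preimage (continuous_apply (A := fun _ => Bool) l)
  exact isClosed_imp (hc l) (by
    simp only [ofPred_forall]
    exact isClosed_iInter fun l' => isClosed_imp (hc l') isClosed_const)

instance : CompactSpace N.Space := isCompact_iff_compactSpace.1 N.isClosed_separated.isCompact

/-- The set of labels given by a point of `N.Space`. -/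
def Space.toSet {N : BlockNet e} (x : N.Space) : Set ℕ := {l | x.1 l = true}

open Classical in
/-- The point of `N.Space` given by a set of labels. -/
noncomputable def ofSet {N : BlockNet e} {S : Set ℕ} (hS : N.Separated S) : N.Space :=
  ⟨fun l => decide (l ∈ S), by simpa using hS⟩

@[simp]
theorem toSet_ofSet {S : Set ℕ} (hS : N.Separated S) : (ofSet hS).toSet = S := by
  ext l; simp [Space.toSet, ofSet]

/-- The points the labels of which ending before `M` are those in `S`. -/
def cyl (S : Set ℕ) (M : ℕ) : Set N.Space :=
  {x | ∀ l, N.hi l ≤ M → (l ∈ x.toSet ↔ l ∈ S)}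

theorem isOpen_cyl (S : Set ℕ) (M : ℕ) : IsOpen (N.cyl S M) := by
  have : N.cyl S M = ⋂ l ∈ {l | N.hi l ≤ M}, {x | l ∈ x.toSet ↔ l ∈ S} := by
    ext x; simp [cyl]
  rw [this]
  refine (N.finite_hi_le M).isOpen_biInter fun l _ => ?_
  exact (isOpen_discrete {b : Bool | b = true ↔ l ∈ S}).preimage
    ((continuous_apply (A := fun _ => Bool) l).comp continuous_subtype_val)

theorem mem_cyl_toSet (x : N.Space) (M : ℕ) : x ∈ N.cyl x.toSet M := fun _ _ => Iff.rfl

theorem exists_cyl_subset {O : Set N.Space} (hO : IsOpen O) {x : N.Space} (hx : x ∈ O) :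
    ∃ M, ∀ M' ≥ M, N.cyl x.toSet M' ⊆ O := by
  obtain ⟨O', hO', rfl⟩ := isOpen_induced_iff.1 hO
  obtain ⟨_, ⟨y, k, rfl⟩, hxy, hsub⟩ :=
    (PiNat.isTopologicalBasis_cylinders fun _ : ℕ => Bool).exists_subset_of_mem_open hx hO'
  rw [PiNat.mem_cylinder_iff] at hxy
  refine ⟨(Finset.range k).sup N.hi, fun M' hM' z hz => hsub ?_⟩
  rw [PiNat.mem_cylinder_iff]
  intro i hi
  rw [← hxy i hi]
  have := hz i ((Finset.le_sup (f := N.hi) (Finset.mem_range.2 hi)).trans hM')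
  exact Bool.eq_iff_iff.2 this

variable {N} in
theorem cyl_subset_cyl {S T : Set ℕ} {M M' : ℕ} (hM : M ≤ M')
    (h : ∀ l, N.hi l ≤ M → (l ∈ T ↔ l ∈ S)) : N.cyl T M' ⊆ N.cyl S M :=
  fun _ hx l hl => (hx l (hl.trans hM)).trans (h l hl)

variable {N} in
theorem cyl_union_subset {S T : Set ℕ} {M M' : ℕ} (hM : M ≤ M') (hT : ∀ l ∈ T, M ≤ N.lo l) :
    N.cyl (S ∪ T) M' ⊆ N.cyl S M := by
  refine cyl_subset_cyl hM fun l hl => ⟨fun h => h.resolve_right fun h' => ?_, Or.inl⟩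
  exact absurd (N.lo_lt_hi l) (not_lt.2 (hl.trans (hT l h')))

/-- The label of u that ends at M belongs to x, so no label of x straddles M: those ending later
begin at M or after and form an extension of u. The extra label `l₀` makes the new block end exactly
at M' + 1. -/
theorem exists_extension_cyl {u : Set ℕ} {M : ℕ} (hu : N.IsBlock u 0 M) {x : N.Space}
    (hx : x ∈ N.cyl u M) {M' : ℕ} (hM : M ≤ M') {l₀ : ℕ} (h0 : N.lo l₀ = M')
    (h1 : N.hi l₀ = M' + 1) :
    ∃ p, N.IsBlock p M (M' + 1) ∧ N.cyl (u ∪ p) (M' + 1) ⊆ N.cyl x.toSet M' := by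
  obtain ⟨l₁, hl₁, hl₁M⟩ := hu.exists_hi_eq
  refine ⟨{l ∈ x.toSet | M < N.hi l ∧ N.hi l ≤ M'} ∪ {l₀}, ⟨?_, ?_, ?_, l₀, Or.inr rfl, h1⟩, ?_⟩
  · refine Separated.union (b := M') (Separated.mono (T := x.toSet) x.2 fun l hl => hl.1)
      (N.separated_singleton l₀) (fun l hl => hl.2.2) ?_
    rintro _ rfl
    exact h0.ge
  · rintro l (⟨hlx, hl, -⟩ | rfl)
    · have hx1 : l₁ ∈ x.toSet := (hx l₁ hl₁M.le).2 hl₁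
      obtain h | h := x.2 l hlx l₁ hx1 (by rintro rfl; omega)
      · have := N.lo_lt_hi l₁; omega
      · omega
    · omega
  · rintro l (⟨-, -, hl⟩ | rfl) <;> omega
  · refine cyl_subset_cyl (by omega) fun l hl => ?_
    constructor
    · rintro (h | h | rfl)
      · exact (hx l (hu.hi_le l h)).2 h
      · exact h.1
      · omega
    · intro h
      by_cases hlM : N.hi l ≤ M
      · exact Or.inl ((hx l hlM).1 h)
      · exact Or.inr (Or.inl ⟨h, by omega, hl⟩)

variable {W : Set (N.Space × N.Space)}

theorem exists_extension_pair (hWo : IsOpen W) (hWd : Dense W) {u v : Set ℕ} {M : ℕ}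
    (hu : N.IsBlock u 0 M) (hv : N.IsBlock v 0 M) :
    ∃ p q M', N.IsBlock p M M' ∧ N.IsBlock q M M' ∧
      N.cyl (u ∪ p) M' ×ˢ N.cyl (v ∪ q) M' ⊆ W := by
  obtain ⟨⟨x, y⟩, ⟨hx, hy⟩, hxy⟩ := hWd.inter_open_nonempty (N.cyl u M ×ˢ N.cyl v M)
    ((N.isOpen_cyl u M).prod (N.isOpen_cyl v M))
    ⟨(ofSet hu.separated, ofSet hv.separated), by simp [cyl], by simp [cyl]⟩
  obtain ⟨U, V, hU, hV, hxU, hyV, hUV⟩ := isOpen_prod_iff.1 hWo x y hxy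
  obtain ⟨M1, hM1⟩ := N.exists_cyl_subset hU hxU
  obtain ⟨M2, hM2⟩ := N.exists_cyl_subset hV hyV
  set M' := max M (max M1 M2)
  obtain ⟨l₀, h0, h1, -⟩ := N.full M' (M' + 1) (Nat.lt_succ_self _)
  obtain ⟨p, hp, hpx⟩ := N.exists_extension_cyl hu hx (le_max_left _ _ : M ≤ M') h0 h1
  obtain ⟨q, hq, hqy⟩ := N.exists_extension_cyl hv hy (le_max_left _ _ : M ≤ M') h0 h1
  refine ⟨p, q, M' + 1, hp, hq, (prod_mono (hpx.trans (hM1 _ ?_)) (hqy.trans (hM2 _ ?_))).trans hUV⟩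
  · exact (le_max_left M1 M2).trans (le_max_right _ _)
  · exact (le_max_right M1 M2).trans (le_max_right _ _)

/-- Treat the finitely many pairs one after another. Lengthening the blocks only shrinks the
cylinders, so what has been achieved for earlier pairs persists. -/
theorem exists_uniform_extension_pair (hWo : IsOpen W) (hWd : Dense W)
    {A : Set (Set ℕ × Set ℕ)} (hA : A.Finite) {M : ℕ}
    (hAM : ∀ a ∈ A, N.IsBlock a.1 0 M ∧ N.IsBlock a.2 0 M) :
    ∃ p q M', N.IsBlock p M M' ∧ N.IsBlock q M M' ∧
      ∀ a ∈ A, N.cyl (a.1 ∪ p) M' ×ˢ N.cyl (a.2 ∪ q) M' ⊆ W := by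
  induction A, hA using Set.Finite.induction_on with
  | empty =>
    obtain ⟨l, -, -, -, hl⟩ := N.exists_isBlock_full (Nat.lt_succ_self M)
    exact ⟨{l}, {l}, M + 1, hl, hl, by simp⟩
  | @insert a A _ _ ih =>
    obtain ⟨p, q, M1, hp, hq, hpq⟩ := ih fun b hb => hAM b (mem_insert_of_mem _ hb)
    obtain ⟨ha1, ha2⟩ := hAM a (mem_insert _ _)
    obtain ⟨p', q', M2, hp', hq', hW⟩ :=
      N.exists_extension_pair hWo hWd (ha1.union hp) (ha2.union hq)
    refine ⟨p ∪ p', q ∪ q', M2, hp.union hp', hq.union hq', ?_⟩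
    rintro b (rfl | hb)
    · rwa [← union_assoc, ← union_assoc]
    · refine Subset.trans ?_ (hpq b hb)
      rw [← union_assoc, ← union_assoc]
      exact prod_mono (cyl_union_subset hp'.lt.le hp'.le_lo) (cyl_union_subset hq'.lt.le hq'.le_lo)

theorem exists_uniform_extension {O : Set N.Space} (hOo : IsOpen O) (hOd : Dense O)
    {A : Set (Set ℕ)} (hA : A.Finite) {M : ℕ} (hAM : ∀ a ∈ A, N.IsBlock a 0 M) :
    ∃ p M', N.IsBlock p M M' ∧ ∀ a ∈ A, N.cyl (a ∪ p) M' ⊆ O := by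
  obtain ⟨p, q, M', hp, hq, h⟩ := N.exists_uniform_extension_pair (W := Prod.snd ⁻¹' O)
    (hOo.preimage continuous_snd) (hOd.preimage isOpenMap_snd) (A := (fun a => (a, a)) '' A)
    (hA.image _) (M := M) (by rintro _ ⟨a, ha, rfl⟩; exact ⟨hAM a ha, hAM a ha⟩)
  refine ⟨q, M', hq, fun a ha y hy => ?_⟩
  have hx : ofSet ((hAM a ha).union hp).separated ∈ N.cyl (a ∪ p) M' := by simp [cyl]
  exact h (a, a) ⟨a, ha, rfl⟩ (mk_mem_prod hx hy)

/-- The linear span of the subspaces with labels in `S`. -/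
def span (S : Set ℕ) : Submodule 𝕜 X := ⨆ l ∈ S, N.sub l

theorem span_union (S T : Set ℕ) : N.span (S ∪ T) = N.span S ⊔ N.span T := iSup_union

theorem span_iUnion {ι : Type*} (S : ι → Set ℕ) : N.span (⋃ i, S i) = ⨆ i, N.span (S i) := by
  simp only [span, mem_iUnion, iSup_exists]
  rw [iSup_comm]

theorem span_singleton (l : ℕ) : N.span {l} = N.sub l := iSup_singleton

theorem span_le_supported {S : Set ℕ} {a b : ℕ} (h : ∀ l ∈ S, a ≤ N.lo l) (h' : ∀ l ∈ S, N.hi l ≤ b) :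
    N.span S ≤ supported e (Ico a b) :=
  iSup₂_le fun l hl => (N.sub_le l).trans (supported_mono e (Ico_subset_Ico (h l hl) (h' l hl)))

variable {N} in
theorem IsBlock.span_le {S : Set ℕ} {a b : ℕ} (h : N.IsBlock S a b) :
    N.span S ≤ supported e (Ico a b) := N.span_le_supported h.le_lo h.hi_le

instance finiteDimensional_sub (l : ℕ) : FiniteDimensional 𝕜 (N.sub l) :=
  have := finiteDimensional_supported e (finite_Ico (N.lo l) (N.hi l))
  Submodule.finiteDimensional_of_le (N.sub_le l)

variable {N} in
theorem IsBlock.finiteDimensional_span {S : Set ℕ} {a b : ℕ} (h : N.IsBlock S a b) :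
    FiniteDimensional 𝕜 (N.span S) :=
  have := finiteDimensional_supported e (finite_Ico a b)
  Submodule.finiteDimensional_of_le h.span_le

theorem analyticSet_isoWithin_span [CompleteSpace X] (L : ℝ) :
    AnalyticSet {z : N.Space × N.Space | IsoWithin L (N.span z.1.toSet).topologicalClosure
      (N.span z.2.toSet).topologicalClosure} := by
  have : TopologicalSpace.IsCompletelyMetrizableSpace Bool := .discrete
  have : PolishSpace (ℕ → Bool) := {}
  have : PolishSpace N.Space := N.isClosed_separated.polishSpace
  have := secondCountableTopology_of_schauderBasis e
  exact (analyticSet_isoWithin L N.sub).preimage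
    (f := fun z : N.Space × N.Space => (z.1.1, z.2.1))
    ((continuous_subtype_val.comp continuous_fst).prodMk
      (continuous_subtype_val.comp continuous_snd))

end BlockNet
end ErgodicBanach

namespace ErgodicBanach

/-! ### The meagre case: reducing `E₀`. -/

section

variable {𝕜 : Type*} [RCLike 𝕜] {X : Type*} [NormedAddCommGroup X] [NormedSpace 𝕜 X]

theorem topologicalClosure_sup_of_finiteDimensional (T A : Submodule 𝕜 X) [FiniteDimensional 𝕜 A] :
    (T ⊔ A).topologicalClosure = T.topologicalClosure ⊔ A := by
  apply le_antisymm
  · exact Submodule.topologicalClosure_minimal _ (sup_le_sup_right T.le_topologicalClosure A)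
      (Submodule.isClosed_sup_finiteDimensional _ A T.isClosed_topologicalClosure)
  · exact sup_le (Submodule.topologicalClosure_mono le_sup_left)
      (le_sup_right.trans (Submodule.le_topologicalClosure _))

theorem finrank_sup_of_disjoint (A B : Submodule 𝕜 X) [FiniteDimensional 𝕜 A]
    [FiniteDimensional 𝕜 B] (h : Disjoint A B) :
    Module.finrank 𝕜 (A ⊔ B : Submodule 𝕜 X) = Module.finrank 𝕜 A + Module.finrank 𝕜 B := by
  have := Submodule.finrank_sup_add_finrank_inf_eq A B
  rwa [h.eq_bot, finrank_bot, add_zero] at this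

theorem isoWithin_topologicalClosure_sup {T A A' : Submodule 𝕜 X} [FiniteDimensional 𝕜 A]
    [FiniteDimensional 𝕜 A'] {n : ℕ} (hA : Module.finrank 𝕜 A = n) (hA' : Module.finrank 𝕜 A' = n)
    (hd : Disjoint T.topologicalClosure A) (hd' : Disjoint T.topologicalClosure A') :
    IsoWithin (5 ^ n) (T ⊔ A).topologicalClosure (T ⊔ A').topologicalClosure := by
  rw [topologicalClosure_sup_of_finiteDimensional, topologicalClosure_sup_of_finiteDimensional]
  exact isoWithin_sup_of_finrank_eq T.isClosed_topologicalClosure hA hA' hd hd'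

end

namespace BlockNet

variable {𝕜 : Type*} [RCLike 𝕜] {X : Type*} [NormedAddCommGroup X] [NormedSpace 𝕜 X]
  {e : SchauderBasis 𝕜 X} (N : BlockNet e)

variable {N} in
theorem IsBlock.finrank_span_union {S T : Set ℕ} {a b c : ℕ} (hS : N.IsBlock S a b)
    (hT : N.IsBlock T b c) : Module.finrank 𝕜 (N.span (S ∪ T)) =
      Module.finrank 𝕜 (N.span S) + Module.finrank 𝕜 (N.span T) := by
  have := hS.finiteDimensional_span
  have := hT.finiteDimensional_span
  rw [span_union]
  refine finrank_sup_of_disjoint _ _ ((disjoint_supported e ?_).mono hS.span_le hT.span_le)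
  exact disjoint_left.2 fun i hi hi' => not_lt.2 hi'.1 hi.2

/-- Append to each block full intervals of total rank that of the other block plus 2. The 2 comes
from a first interval one longer than that rank, hence nonempty, and a last unit interval that makes
both blocks end at the same place. -/
theorem exists_isBlock_finrank_eq {p q : Set ℕ} {a b : ℕ} (hp : N.IsBlock p a b)
    (hq : N.IsBlock q a b) : ∃ r s c, N.IsBlock r b c ∧ N.IsBlock s b c ∧
      Module.finrank 𝕜 (N.span (p ∪ r)) = Module.finrank 𝕜 (N.span (q ∪ s)) := by
  set d := Module.finrank 𝕜 (N.span p)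
  set d' := Module.finrank 𝕜 (N.span q)
  have key : ∀ k, ∃ r, N.IsBlock r b (b + d + d' + 2) ∧
      (k ≤ d + d' → Module.finrank 𝕜 (N.span r) = k + 2) := by
    intro k
    by_cases hk : k ≤ d + d'
    · obtain ⟨l, -, -, hl, hlb⟩ := N.exists_isBlock_full (a := b) (b := b + k + 1) (by omega)
      obtain ⟨l', -, -, hl', hlb'⟩ := N.exists_isBlock_full
        (a := b + d + d' + 1) (b := b + d + d' + 2) (by omega)
      have h1 : N.IsBlock {l} b (b + k + 1) := hlb
      have h2 := hlb'.mono_left (a' := b + k + 1) (by omega)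
      refine ⟨{l} ∪ {l'}, h1.union h2, fun _ => ?_⟩
      rw [h1.finrank_span_union h2, span_singleton, span_singleton, hl, hl',
        finrank_supported_Ico, finrank_supported_Ico]
      omega
    · obtain ⟨l, -, -, -, hlb⟩ := N.exists_isBlock_full (a := b) (b := b + d + d' + 2) (by omega)
      exact ⟨{l}, hlb, fun h => absurd h hk⟩
  obtain ⟨r, hr, hr'⟩ := key d'
  obtain ⟨s, hs, hs'⟩ := key d
  refine ⟨r, s, _, hr, hs, ?_⟩
  rw [hp.finrank_span_union hr, hq.finrank_span_union hs, hr' (by omega), hs' (by omega)]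
  omega

theorem finite_setOf_isBlock (M : ℕ) : {u : Set ℕ | N.IsBlock u 0 M}.Finite :=
  (N.finite_hi_le M).finite_subsets.subset fun _ hu => hu.hi_le

theorem exists_splitting {W : Set (N.Space × N.Space)} (hWo : IsOpen W) (hWd : Dense W) (M : ℕ) :
    ∃ p q M', N.IsBlock p M M' ∧ N.IsBlock q M M' ∧
      Module.finrank 𝕜 (N.span p) = Module.finrank 𝕜 (N.span q) ∧
      ∀ u v, N.IsBlock u 0 M → N.IsBlock v 0 M → N.cyl (u ∪ p) M' ×ˢ N.cyl (v ∪ q) M' ⊆ W := by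
  obtain ⟨p, q, M', hp, hq, h⟩ := N.exists_uniform_extension_pair hWo hWd
    ((N.finite_setOf_isBlock M).prod (N.finite_setOf_isBlock M)) (M := M) fun a ha => ha
  obtain ⟨r, s, M'', hr, hs, hrs⟩ := N.exists_isBlock_finrank_eq hp hq
  refine ⟨p ∪ r, q ∪ s, M'', hp.union hr, hq.union hs, hrs, fun u v hu hv => ?_⟩
  refine Subset.trans ?_ (h (u, v) ⟨hu, hv⟩)
  rw [← union_assoc, ← union_assoc]
  exact prod_mono (cyl_union_subset hr.lt.le hr.le_lo) (cyl_union_subset hs.lt.le hs.le_lo)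

/-- A scheme of pairs of blocks on successive intervals. -/
structure Splitting where
  base : Set ℕ
  M : ℕ → ℕ
  block : ℕ → Bool → Set ℕ
  base_isBlock : N.IsBlock base 0 (M 0)
  isBlock : ∀ n i, N.IsBlock (block n i) (M n) (M (n + 1))
  finrank_eq : ∀ n i, Module.finrank 𝕜 (N.span (block n i)) =
    Module.finrank 𝕜 (N.span (block n false))

namespace Splitting

variable {N} (s : N.Splitting) (α β : ℕ → Bool)

/-- The blocks before stage `n` selected by `α`. -/
def pre (n : ℕ) : Set ℕ := s.base ∪ ⋃ i ∈ Iio n, s.block i (α i)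

/-- The blocks from stage `n` on selected by `α`. -/
def tail (n : ℕ) : Set ℕ := ⋃ i ∈ Ici n, s.block i (α i)

/-- All blocks selected by `α`. -/
def all : Set ℕ := s.base ∪ ⋃ i, s.block i (α i)

theorem monotone_M : Monotone s.M := monotone_nat_of_le_succ fun n => (s.isBlock n false).lt.le

theorem pre_succ (n : ℕ) : s.pre α (n + 1) = s.pre α n ∪ s.block n (α n) := by
  ext l
  simp only [pre, mem_union, mem_iUnion, mem_Iio, exists_prop, Nat.lt_succ_iff_lt_or_eq, or_and_right,
    exists_or, exists_eq_left, or_assoc]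

theorem pre_zero : s.pre α 0 = s.base := by simp [pre]

theorem pre_union_tail (n : ℕ) : s.pre α n ∪ s.tail α n = s.all α := by
  ext l
  simp only [pre, tail, all, mem_union, mem_iUnion, mem_Iio, mem_Ici, exists_prop, or_assoc,
    ← exists_or, ← or_and_right, lt_or_ge, true_and]

theorem pre_isBlock (n : ℕ) : N.IsBlock (s.pre α n) 0 (s.M n) := by
  induction n with
  | zero => rw [pre_zero]; exact s.base_isBlock
  | succ n ih => rw [pre_succ]; exact ih.union (s.isBlock n _)

theorem pre_congr {n : ℕ} (h : ∀ i < n, α i = β i) : s.pre α n = s.pre β n := by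
  simp only [pre]
  congr 1
  exact iUnion₂_congr fun i hi => by rw [h i hi]

theorem tail_congr {n : ℕ} (h : ∀ i, n ≤ i → α i = β i) : s.tail α n = s.tail β n :=
  iUnion₂_congr fun i hi => by rw [h i hi]

theorem le_lo_of_mem_tail {n l : ℕ} (hl : l ∈ s.tail α n) : s.M n ≤ N.lo l := by
  simp only [tail, mem_iUnion] at hl
  obtain ⟨i, hi, hl⟩ := hl
  exact (s.monotone_M hi).trans ((s.isBlock i _).le_lo l hl)

theorem monotone_pre : Monotone (s.pre α) :=
  monotone_nat_of_le_succ fun n => by rw [pre_succ]; exact subset_union_left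

theorem iUnion_pre : ⋃ n, s.pre α n = s.all α := by
  apply subset_antisymm
  · exact iUnion_subset fun n => by rw [← s.pre_union_tail α n]; exact subset_union_left
  · rintro l (hl | hl)
    · exact mem_iUnion.2 ⟨0, Or.inl hl⟩
    · obtain ⟨i, hi⟩ := mem_iUnion.1 hl
      exact mem_iUnion.2 ⟨i + 1, by rw [pre_succ]; exact Or.inr hi⟩

theorem separated_all : N.Separated (s.all α) := by
  intro l hl l' hl' hne
  rw [← iUnion_pre] at hl hl'
  obtain ⟨m, hm⟩ := mem_iUnion.1 hl
  obtain ⟨n, hn⟩ := mem_iUnion.1 hl'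
  exact (s.pre_isBlock α (max m n)).separated l (s.monotone_pre α (le_max_left m n) hm) l'
    (s.monotone_pre α (le_max_right m n) hn) hne

/-- The point of the space of configurations given by the blocks selected by `α`. -/
noncomputable def point : N.Space := ofSet (s.separated_all α)

theorem point_mem_cyl (n : ℕ) : s.point α ∈ N.cyl (s.pre α n ∪ s.block n (α n)) (s.M (n + 1)) := by
  rw [← pre_succ]
  refine cyl_union_subset le_rfl (T := s.tail α (n + 1)) (fun l hl => s.le_lo_of_mem_tail α hl) ?_
  rw [pre_union_tail]
  intro l _
  rw [point, toSet_ofSet]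

/-- The closed span of the blocks selected by `α`. -/
noncomputable def space : ClosedSubmodule 𝕜 X := (N.span (s.all α)).closure

theorem finrank_span_pre (n : ℕ) :
    Module.finrank 𝕜 (N.span (s.pre α n)) = Module.finrank 𝕜 (N.span (s.pre β n)) := by
  induction n with
  | zero => rw [pre_zero, pre_zero]
  | succ n ih =>
    rw [pre_succ, pre_succ, (s.pre_isBlock α n).finrank_span_union (s.isBlock n _),
      (s.pre_isBlock β n).finrank_span_union (s.isBlock n _), ih, s.finrank_eq, s.finrank_eq n (β n)]

theorem disjoint_closure_tail (n : ℕ) :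
    Disjoint (N.span (s.tail α n)).topologicalClosure (N.span (s.pre β n)) := by
  refine (disjoint_supported e (J := Ici (s.M n)) (K := Ico 0 (s.M n)) ?_).mono
    (Submodule.topologicalClosure_minimal _ ?_ (isClosed_supported e _)) (s.pre_isBlock β n).span_le
  · exact disjoint_left.2 fun i hi hi' => not_lt.2 hi hi'.2
  · exact iSup₂_le fun l hl => (N.sub_le l).trans (supported_mono e fun i hi =>
      (s.le_lo_of_mem_tail α hl).trans hi.1)

variable {α β} in
-- From some stage on the tails coincide, and the initial parts have the same rank by `finrank_eq`.
theorem isomorphic_space (h : E₀ α β) : Isomorphic (s.space α) (s.space β) := by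
  obtain ⟨n, hn⟩ := h
  have := (s.pre_isBlock α n).finiteDimensional_span
  have := (s.pre_isBlock β n).finiteDimensional_span
  have h := isoWithin_topologicalClosure_sup (s.finrank_span_pre α β n) rfl
    (s.disjoint_closure_tail α α n) (s.disjoint_closure_tail α β n)
  rw [sup_comm, ← span_union, pre_union_tail, sup_comm, ← span_union, s.tail_congr α β hn,
    pre_union_tail] at h
  exact IsoWithin.isomorphic (Y := s.space α) (Z := s.space β) h

theorem mem_span_all_iff {x : X} : x ∈ N.span (s.all α) ↔ ∃ n, x ∈ N.span (s.pre α n) := by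
  rw [← iUnion_pre, span_iUnion, Submodule.mem_iSup_of_directed]
  exact Monotone.directed_le fun m n hmn => iSup_le_iSup_of_subset (s.monotone_pre α hmn)

/-- An open set meets the closed span iff it meets the span of some finite stage, which depends on
finitely many coordinates. Generators of the Effros structure therefore have open preimages. -/
theorem measurable_space : Measurable s.space := by
  refine measurable_generateFrom ?_
  rintro _ ⟨U, hU, rfl⟩
  have : s.space ⁻¹' {Y : ClosedSubmodule 𝕜 X | ((Y : Set X) ∩ U).Nonempty} =
      ⋃ n, {α | ((N.span (s.pre α n) : Set X) ∩ U).Nonempty} := by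
    ext α
    simp only [mem_preimage, mem_ofPred_eq, mem_iUnion]
    have h1 : ((s.space α : Set X) ∩ U).Nonempty ↔ ((N.span (s.all α) : Set X) ∩ U).Nonempty :=
      closure_inter_open_nonempty_iff hU
    rw [h1]
    constructor
    · rintro ⟨x, hx, hxU⟩
      obtain ⟨n, hn⟩ := (s.mem_span_all_iff α).1 hx
      exact ⟨n, x, hn, hxU⟩
    · rintro ⟨n, x, hx, hxU⟩
      exact ⟨x, (s.mem_span_all_iff α).2 ⟨n, hx⟩, hxU⟩
  rw [this]
  refine MeasurableSet.iUnion fun n => IsOpen.measurableSet ?_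
  rw [(PiNat.isTopologicalBasis_cylinders fun _ : ℕ => Bool).isOpen_iff]
  intro α hα
  refine ⟨PiNat.cylinder α n, ⟨α, n, rfl⟩, PiNat.self_mem_cylinder α n, fun β hβ => ?_⟩
  rw [mem_ofPred_eq, s.pre_congr β α (PiNat.mem_cylinder_iff.1 hβ)]
  exact hα

end Splitting

theorem exists_splitting_of_dense {O : ℕ → Set (N.Space × N.Space)} (hOo : ∀ n, IsOpen (O n))
    (hOd : ∀ n, Dense (O n)) : ∃ s : N.Splitting, ∀ n u v, N.IsBlock u 0 (s.M n) →
      N.IsBlock v 0 (s.M n) → N.cyl (u ∪ s.block n false) (s.M (n + 1)) ×ˢ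
        N.cyl (v ∪ s.block n true) (s.M (n + 1)) ⊆ O n := by
  choose p q M' hp hq hpq hO using fun n M => N.exists_splitting (hOo n) (hOd n) M
  obtain ⟨l, -, -, -, hl⟩ := N.exists_isBlock_full Nat.zero_lt_one
  let M : ℕ → ℕ := fun n => Nat.rec 1 (fun n m => M' n m) n
  refine ⟨{ base := {l}, M := M, block := fun n i => if i then q n (M n) else p n (M n)
            base_isBlock := hl, isBlock := ?_, finrank_eq := ?_ }, ?_⟩
  · rintro n (_ | _)
    · exact hp n (M n)
    · exact hq n (M n)
  · rintro n (_ | _)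
    · rfl
    · exact (hpq n (M n)).symm
  · exact fun n u v hu hv => hO n (M n) u v hu hv

theorem isErgodic_of_isMeagre (h : ∀ L : ℕ, IsMeagre {z : N.Space × N.Space |
    IsoWithin (L : ℝ) (N.span z.1.toSet).topologicalClosure
      (N.span z.2.toSet).topologicalClosure}) : IsErgodic 𝕜 X := by
  obtain ⟨O, hOo, hOd, hOa, hO⟩ := exists_antitone_dense_of_isMeagre (isMeagre_iUnion h)
  obtain ⟨s, hs⟩ := N.exists_splitting_of_dense hOo hOd
  -- The blocks force a pair into `O n` only in the order false, true. If α and β differ infinitely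
  -- often, one of the two orders occurs infinitely often, and since the `O n` decrease this puts
  -- the pair in all of them.
  have key : ∀ α β : ℕ → Bool, {n | α n = false ∧ β n = true}.Infinite →
      ¬ Isomorphic (s.space α) (s.space β) := by
    intro α β hinf hiso
    obtain ⟨L, hL⟩ := hiso.exists_isoWithin
    refine hO (s.point α, s.point β) (fun m => ?_) (mem_iUnion.2 ⟨L, ?_⟩)
    · obtain ⟨n, ⟨hα, hβ⟩, hmn⟩ := hinf.exists_gt m
      refine hOa hmn.le (hs n _ _ (s.pre_isBlock α n) (s.pre_isBlock β n) (mk_mem_prod ?_ ?_))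
      · simpa [hα] using s.point_mem_cyl α n
      · simpa [hβ] using s.point_mem_cyl β n
    · simp only [Splitting.point, mem_ofPred_eq, toSet_ofSet]
      exact hL
  refine ⟨s.space, s.measurable_space, fun α β => ⟨s.isomorphic_space, fun hiso => ?_⟩⟩
  by_contra hne
  have hinf : {n | α n ≠ β n}.Infinite := by
    intro hf
    obtain ⟨n, hn⟩ := hf.bddAbove
    refine hne ⟨n + 1, fun m hm => by_contra fun h' => ?_⟩
    have := hn h'
    omega
  have hun : {n | α n ≠ β n} ⊆ {n | α n = false ∧ β n = true} ∪ {n | β n = false ∧ α n = true} := by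
    intro n hn
    simp only [mem_ofPred_eq, mem_union] at hn ⊢
    cases hα : α n <;> cases hβ : β n <;> simp_all
  obtain h' | h' := infinite_union.1 (hinf.mono hun)
  · exact key α β h' hiso
  · exact key β α h' ⟨hiso.some.symm⟩

end BlockNet
end ErgodicBanach

namespace ErgodicBanach

/-! ### Decompositions on the basis: intervals, cutting and perturbation. -/

section Decompositions

variable {𝕜 : Type*} [RCLike 𝕜] {X : Type*} [NormedAddCommGroup X] [NormedSpace 𝕜 X]
  {e : SchauderBasis 𝕜 X}

variable (e) in
/-- The `Y k` are supported on the successive intervals `[a k, b k)`. -/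
structure IsBlocking (a b : ℕ → ℕ) (Y : ℕ → Submodule 𝕜 X) : Prop where
  lt : ∀ k, a k < b k
  le_succ : ∀ k, b k ≤ a (k + 1)
  le_supported : ∀ k, Y k ≤ supported e (Ico (a k) (b k))

namespace IsBlocking

variable {a b : ℕ → ℕ} {Y : ℕ → Submodule 𝕜 X} 

theorem strictMono (hY : IsBlocking e a b Y) : StrictMono a :=
  strictMono_nat_of_lt_succ fun k => (hY.lt k).trans_le (hY.le_succ k)

theorem le_of_lt (hY : IsBlocking e a b Y) {j k : ℕ} (h : j < k) : b j ≤ a k :=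
  (hY.le_succ j).trans (hY.strictMono.monotone h)

theorem disjoint (hY : IsBlocking e a b Y) {j k : ℕ} (h : j ≠ k) : Disjoint (Ico (a j) (b j)) (Ico (a k) (b k)) := by
  refine disjoint_left.2 fun i hi hi' => ?_
  simp only [mem_Ico] at hi hi'
  obtain h | h := h.lt_or_gt <;> have := hY.le_of_lt h <;> omega

end IsBlocking

/-- Take the least and the greatest element of the supports. They are bounded because the next term
is nonzero and lies beyond. -/
theorem IsFDDSeq.exists_isBlocking {E : ℕ → Submodule 𝕜 X} (hE : IsFDDSeq e E) :
    ∃ a b : ℕ → ℕ, IsBlocking e a b E ∧ (∀ k, ∃ x ∈ E k, e.coord (a k) x ≠ 0) ∧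
      ∀ k, ∃ i, b k = i + 1 ∧ ∃ x ∈ E k, e.coord i x ≠ 0 := by
  let S : ℕ → Set ℕ := fun k => {n | ∃ x ∈ E k, e.coord n x ≠ 0}
  have hne : ∀ k, (S k).Nonempty := by
    intro k
    obtain ⟨x, hx, hx0⟩ := Submodule.exists_mem_ne_zero_of_ne_bot (hE.ne_bot k)
    by_contra hemp
    refine hx0 (eq_zero_of_coord_eq_zero e fun i => by_contra fun hi => hemp ⟨i, x, hx, hi⟩)
  have hlt : ∀ k, ∀ m ∈ S k, ∀ n ∈ S (k + 1), m < n := by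
    rintro k m ⟨x, hx, hm⟩ n ⟨y, hy, hn⟩
    exact hE.successive k x hx y hy m hm n hn
  have hbdd : ∀ k, BddAbove (S k) := fun k => ⟨_, fun m hm => (hlt k m hm _ (hne (k + 1)).some_mem).le⟩
  have hinf : ∀ k, sInf (S k) ∈ S k := fun k => Nat.sInf_mem (hne k)
  have hsup : ∀ k, sSup (S k) ∈ S k := fun k => Nat.sSup_mem (hne k) (hbdd k)
  refine ⟨fun k => sInf (S k), fun k => sSup (S k) + 1, ⟨fun k => ?_, fun k => ?_, fun k x hx i hi => ?_⟩,
    hinf, fun k => ⟨_, rfl, hsup k⟩⟩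
  · exact Nat.lt_succ_of_le (Nat.sInf_le (hsup k))
  · exact hlt k _ (hsup k) _ (hinf (k + 1))
  · by_contra h
    exact hi ⟨Nat.sInf_le ⟨x, hx, h⟩, Nat.lt_succ_of_le (le_csSup (hbdd k) ⟨x, hx, h⟩)⟩

theorem IsBlocking.iSup_lt_le_supported {a b : ℕ → ℕ} {E : ℕ → Submodule 𝕜 X}
    (hE : IsBlocking e a b E) (m : ℕ) : ⨆ k < m + 1, E k ≤ supported e (Ico 0 (b m)) := by
  refine iSup₂_le fun k hk => (hE.le_supported k).trans (supported_mono e (Ico_subset_Ico (by omega) ?_))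
  obtain h | rfl := Nat.lt_succ_iff_lt_or_eq.1 hk
  · exact (hE.le_of_lt h).trans (hE.lt m).le
  · exact le_rfl

theorem IsBlocking.finrank_iSup_lt {a b : ℕ → ℕ} {E : ℕ → Submodule 𝕜 X}
    (hE : IsBlocking e a b E) (hne : ∀ k, E k ≠ ⊥) (m : ℕ) :
    FiniteDimensional 𝕜 (⨆ k < m, E k : Submodule 𝕜 X) ∧
      m ≤ Module.finrank 𝕜 (⨆ k < m, E k : Submodule 𝕜 X) := by
  have hfE : ∀ k, FiniteDimensional 𝕜 (E k) := fun k =>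
    have := finiteDimensional_supported e (finite_Ico (a k) (b k))
    Submodule.finiteDimensional_of_le (hE.le_supported k)
  induction m with
  | zero =>
    have : (⨆ k < 0, E k) = ⊥ := by simp
    exact ⟨this ▸ (inferInstance : FiniteDimensional 𝕜 (⊥ : Submodule 𝕜 X)), Nat.zero_le _⟩
  | succ m ih =>
    obtain ⟨_, ih⟩ := ih
    have hd : Disjoint (⨆ k < m, E k) (E m) := by
      cases m with
      | zero => simp
      | succ m =>
        refine (disjoint_supported e (J := Ico 0 (b m)) (K := Ico (a (m + 1)) (b (m + 1))) ?_).mono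
          (hE.iSup_lt_le_supported m) (hE.le_supported _)
        exact disjoint_left.2 fun i hi hi' => not_lt.2 hi'.1 (hi.2.trans_le (hE.le_succ m))
    rw [Nat.iSup_lt_succ]
    refine ⟨inferInstance, ?_⟩
    rw [finrank_sup_of_disjoint _ _ hd]
    have := Submodule.one_le_finrank_iff.2 (hne m)
    omega

/-- The first n + 1 terms span U of dimension at least n + 1, and the part of U supported from n on
has codimension at most n. Hence it contains a subspace B of codimension exactly n + 1 in U. Use B
as the new first term, on an interval beginning at n, and a complement A of B in U as the removed
piece. This frees the coordinates below n at a cost in dimension that does not depend on E. -/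
theorem IsBlocking.exists_cut {a b : ℕ → ℕ} {E : ℕ → Submodule 𝕜 X} (hE : IsBlocking e a b E)
    (hne : ∀ k, E k ≠ ⊥) (n : ℕ) :
    ∃ (a' b' : ℕ → ℕ) (Y : ℕ → Submodule 𝕜 X) (A : Submodule 𝕜 X), IsBlocking e a' b' Y ∧
      a' 0 = n ∧ (∀ k > n, ∃ j, Y j = E k ∧ a' j = a k ∧ b' j = b k) ∧ FiniteDimensional 𝕜 A ∧
      Module.finrank 𝕜 A = n + 1 ∧ ⨆ k, E k = (⨆ j, Y j) ⊔ A ∧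
      Disjoint (⨆ j, Y j).topologicalClosure A := by
  set U := ⨆ k < n + 1, E k
  obtain ⟨hUf, hU⟩ : FiniteDimensional 𝕜 U ∧ n + 1 ≤ Module.finrank 𝕜 U :=
    hE.finrank_iSup_lt hne (n + 1)
  have hUs : U ≤ supported e (Ico 0 (b n)) := hE.iSup_lt_le_supported n
  have h1 := finrank_le_finrank_inf_supported e U n
  have : FiniteDimensional 𝕜 (U ⊓ supported e (Ici n) : Submodule 𝕜 X) :=
    Submodule.finiteDimensional_of_le inf_le_left
  obtain ⟨B, hBU, hB⟩ := exists_le_finrank_eq (A := U ⊓ supported e (Ici n))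
    (m := Module.finrank 𝕜 U - (n + 1)) (by omega)
  obtain ⟨C, hC⟩ := B.exists_isCompl
  have hBU' : B ≤ U := hBU.trans inf_le_left
  have hBA : Disjoint B (C ⊓ U) := hC.disjoint.mono_right inf_le_left
  have hsup : B ⊔ C ⊓ U = U := by rw [← sup_inf_assoc_of_le C hBU', hC.sup_eq_top, top_inf_eq]
  have : FiniteDimensional 𝕜 B := Submodule.finiteDimensional_of_le hBU'
  have : FiniteDimensional 𝕜 (C ⊓ U : Submodule 𝕜 X) := Submodule.finiteDimensional_of_le inf_le_right
  have hfr := finrank_sup_of_disjoint _ _ hBA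
  rw [hsup] at hfr
  let Y : ℕ → Submodule 𝕜 X := fun j => Nat.casesOn j B fun i => E (n + 1 + i)
  have hYsup : ⨆ j, Y j = (⨆ i, E (n + 1 + i)) ⊔ B := by
    apply le_antisymm
    · refine iSup_le fun j => ?_
      cases j with
      | zero => exact le_sup_right
      | succ i => exact (le_iSup (fun i => E (n + 1 + i)) i).trans le_sup_left
    · exact sup_le (iSup_le fun i => le_iSup Y (i + 1)) (le_iSup Y 0)
  have hn : n ≤ a n := hE.strictMono.le_apply
  refine ⟨fun j => Nat.casesOn j n fun i => a (n + 1 + i), fun j => b (n + j), Y, C ⊓ U,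
    ⟨?_, ?_, ?_⟩, rfl, ?_, inferInstance, by omega, ?_, ?_⟩
  · rintro (_ | i)
    · exact hn.trans_lt (hE.lt n)
    · simpa only [add_assoc, add_comm 1 i] using hE.lt (n + 1 + i)
  · intro j
    simpa only [add_right_comm n 1 j] using hE.le_succ (n + j)
  · rintro (_ | i)
    · intro x hx j hj
      have h2 := hBU hx
      by_cases hjn : j < n
      · exact h2.2 j (not_le.2 hjn)
      · exact hUs h2.1 j fun h3 => hj ⟨not_lt.1 hjn, h3.2⟩
    · simpa only [Y, add_assoc, add_comm 1 i] using hE.le_supported (n + 1 + i)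
  · intro k hk
    obtain ⟨i, rfl⟩ := Nat.exists_eq_add_of_lt hk
    refine ⟨i + 1, ?_, ?_, rfl⟩
    · simp only [Y, add_right_comm n 1 i]
    · simp only [add_right_comm n 1 i]
  · rw [hYsup, sup_assoc, hsup]
    apply le_antisymm
    · refine iSup_le fun k => ?_
      by_cases hk : k < n + 1
      · exact (le_iSup₂ (f := fun k (_ : k < n + 1) => E k) k hk).trans le_sup_right
      · obtain ⟨i, rfl⟩ := Nat.exists_eq_add_of_le (not_lt.1 hk)
        exact (le_iSup (fun i => E (n + 1 + i)) i).trans le_sup_left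
    · exact sup_le (iSup_le fun i => le_iSup E _) (iSup₂_le fun k _ => le_iSup E k)
  · rw [hYsup, topologicalClosure_sup_of_finiteDimensional, Submodule.disjoint_def]
    intro x hx hxA
    obtain ⟨r, hr, y, hy, rfl⟩ := Submodule.mem_sup.1 hx
    have hr' : r ∈ supported e (Ici (b n)) := by
      refine Submodule.topologicalClosure_minimal _ (iSup_le fun i => (hE.le_supported _).trans
        (supported_mono e fun j hj => ?_)) (isClosed_supported e _) hr
      exact (hE.le_of_lt (by omega : n < n + 1 + i)).trans hj.1
    have hrU : r ∈ U := by simpa using U.sub_mem hxA.2 (hBU' hy)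
    have hr0 : r = 0 := Submodule.disjoint_def.1 (disjoint_supported e (J := Ici (b n))
      (K := Ico 0 (b n)) (disjoint_left.2 fun i hi hi' => not_lt.2 hi hi'.2)) r hr' (hUs hrU)
    rw [hr0, zero_add] at hxA ⊢
    exact Submodule.disjoint_def.1 hBA y hy hxA

/-- The norms sum to at most 1/2, so the identity plus the sum of the `T j` changes norms by a
factor at most 2. -/
theorem exists_perturbation [CompleteSpace X] {T : ℕ → X →L[𝕜] X}
    (hT : ∀ j, ‖T j‖ ≤ (1 / 2) ^ (j + 2)) :
    ∃ S : X →ₗ[𝕜] X, (∀ y, ‖y‖ ≤ 2 * ‖S y‖ ∧ ‖S y‖ ≤ 2 * ‖y‖) ∧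
      ∀ j y, (∀ i ≠ j, T i y = 0) → S y = (LinearMap.id + (T j).toLinearMap : X →ₗ[𝕜] X) y := by
  have hg : HasSum (fun j : ℕ => (1 / 2 : ℝ) ^ (j + 2)) (1 / 2) := by
    have := (hasSum_geometric_two).mul_right ((1 / 2 : ℝ) ^ 2)
    simp only [← pow_add] at this
    norm_num at this ⊢
    exact this
  have hs : Summable T := Summable.of_norm_bounded hg.summable hT
  have hn : ‖∑' j, T j‖ ≤ 1 / 2 := tsum_of_norm_bounded hg hT
  have hny : ∀ y, ‖(∑' j, T j) y‖ ≤ 1 / 2 * ‖y‖ := fun y => (∑' j, T j).le_of_opNorm_le hn y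
  refine ⟨LinearMap.id + (∑' j, T j : X →L[𝕜] X).toLinearMap, fun y => ?_, fun j y hy => ?_⟩
  · simp only [LinearMap.add_apply, LinearMap.id_apply, ContinuousLinearMap.coe_coe]
    have h1 := norm_add_le y ((∑' j, T j) y)
    have h2 := norm_sub_le (y + (∑' j, T j) y) ((∑' j, T j) y)
    rw [add_sub_cancel_right] at h2
    have := hny y
    constructor <;> linarith [norm_nonneg y]
  · have h1 : HasSum (fun i => T i y) ((∑' j, T j) y) :=
      (ContinuousLinearMap.apply 𝕜 X y).hasSum hs.hasSum
    have h2 : (∑' j, T j) y = T j y := h1.unique (hasSum_single j hy)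
    simp only [LinearMap.add_apply, LinearMap.id_apply, ContinuousLinearMap.coe_coe, h2]

end Decompositions

end ErgodicBanach

namespace ErgodicBanach

/-! ### The nonmeagre case: generic cylinders and anchor blocks. -/

namespace BlockNet

variable {𝕜 : Type*} [RCLike 𝕜] {X : Type*} [NormedAddCommGroup X] [NormedSpace 𝕜 X]
  {e : SchauderBasis 𝕜 X} (N : BlockNet e)

theorem exists_isBlock_cyl_subset {U : Set N.Space} (hU : IsOpen U) {y : N.Space} (hy : y ∈ U) :
    ∃ t n, N.IsBlock t 0 n ∧ N.cyl t n ⊆ U := by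
  obtain ⟨M, hM⟩ := N.exists_cyl_subset hU hy
  obtain ⟨l, h1, h2, -, hl⟩ := N.exists_isBlock_full (Nat.lt_succ_self M)
  refine ⟨{l ∈ y.toSet | N.hi l ≤ M} ∪ {l}, M + 1, ⟨?_, fun _ _ => Nat.zero_le _, ?_, l, Or.inr rfl, h2⟩,
    Subset.trans ?_ (hM M le_rfl)⟩
  · exact Separated.union (Separated.mono (T := y.toSet) y.2 fun l hl => hl.1) hl.separated
      (fun l hl => hl.2) hl.le_lo
  · rintro l' (hl' | rfl)
    · exact hl'.2.trans (Nat.le_succ M)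
    · exact h2.le
  · refine (cyl_union_subset (Nat.le_succ M) hl.le_lo).trans (cyl_subset_cyl le_rfl fun l' hl' => ?_)
    exact ⟨fun h => h.1, fun h => ⟨h, hl'⟩⟩

/-- The relation is comeagre in some open rectangle, and so is its section at some x in the first
side. -/
theorem exists_generic_cyl [CompleteSpace X] {L : ℝ} (h : ¬ IsMeagre {z : N.Space × N.Space |
    IsoWithin L (N.span z.1.toSet).topologicalClosure (N.span z.2.toSet).topologicalClosure}) :
    ∃ (x : N.Space) (t : Set ℕ) (n : ℕ) (O : ℕ → Set N.Space), N.IsBlock t 0 n ∧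
      (∀ k, IsOpen (O k)) ∧ (∀ k, Dense (O k)) ∧ Antitone O ∧ ∀ y ∈ N.cyl t n, (∀ k, y ∈ O k) →
        IsoWithin L (N.span x.toSet).topologicalClosure (N.span y.toSet).topologicalClosure := by
  obtain ⟨U, hUo, ⟨⟨x₀, y₀⟩, hU⟩, hm⟩ :=
    exists_isOpen_isMeagre_diff (N.analyticSet_isoWithin_span L) h
  obtain ⟨V, V', hV, hV', hxV, hyV', hVU⟩ := isOpen_prod_iff.1 hUo x₀ y₀ hU
  obtain ⟨x, hx, hmx⟩ := exists_isMeagre_section hm hV ⟨x₀, hxV⟩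
  obtain ⟨O, hOo, hOd, hOa, hO⟩ := exists_antitone_dense_of_isMeagre hmx
  obtain ⟨t, n, ht, htV⟩ := N.exists_isBlock_cyl_subset hV' hyV'
  refine ⟨x, t, n, O, ht, hOo, hOd, hOa, fun y hy hyO => by_contra fun hxy => ?_⟩
  exact hO y hyO ⟨hVU (mk_mem_prod hx (htV hy)), hxy⟩

/-- A sequence of blocks `p n`, each of which forces its extensions to be in the open set `O n`
whatever comes before, together with a gap of length `c` and a final label on an interval
of length one. -/
structure Anchor (O : ℕ → Set N.Space) (start c : ℕ) where
  M : ℕ → ℕ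
  M' : ℕ → ℕ
  p : ℕ → Set ℕ
  gap : ℕ → ℕ
  last : ℕ → ℕ
  M_zero : M 0 = start
  M_succ : ∀ n, M (n + 1) = M' n + c + 1
  p_isBlock : ∀ n, N.IsBlock (p n) (M n) (M' n)
  basis_mem : ∀ n, e (M n) ∈ N.span (p n)
  gap_isBlock : ∀ n, N.IsBlock {gap n} (M' n) (M' n + c)
  sub_gap : ∀ n, N.sub (gap n) = supported e (Ico (M' n) (M' n + c))
  last_isBlock : ∀ n, N.IsBlock {last n} (M' n + c) (M (n + 1))
  basis_mem_last : ∀ n, e (M' n + c) ∈ N.sub (last n)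
  cyl_subset : ∀ n u, N.Separated u → (∀ l ∈ u, N.hi l ≤ M n) → N.cyl (u ∪ p n) (M' n) ⊆ O n

theorem nonempty_anchor {O : ℕ → Set N.Space} (hOo : ∀ k, IsOpen (O k)) (hOd : ∀ k, Dense (O k))
    (start : ℕ) {c : ℕ} (hc : 0 < c) : Nonempty (N.Anchor O start c) := by
  have step : ∀ n M : ℕ, ∃ (p : Set ℕ) (M' : ℕ), N.IsBlock p M M' ∧ e M ∈ N.span p ∧
      ∀ u, N.Separated u → (∀ l ∈ u, N.hi l ≤ M) → N.cyl (u ∪ p) M' ⊆ O n := by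
    intro n M
    obtain ⟨l, -, -, hl, hlb⟩ := N.exists_isBlock_full (Nat.lt_succ_self M)
    have hfin : {u : Set ℕ | N.Separated u ∧ ∀ l ∈ u, N.hi l ≤ M}.Finite :=
      (N.finite_hi_le M).finite_subsets.subset fun u hu => hu.2
    obtain ⟨p, M', hp, hO⟩ := N.exists_uniform_extension (hOo n) (hOd n)
      -- An admissible u need not have a label ending at M. Adding the full label on [M, M + 1)
      -- turns it into a block, and also puts `e M` into the span.
      (hfin.image fun u => u ∪ {l}) (M := M + 1) (by
        rintro _ ⟨u, ⟨hu, huM⟩, rfl⟩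
        refine ⟨hu.union hlb.separated huM hlb.le_lo, fun _ _ => Nat.zero_le _, ?_, ?_⟩
        · rintro l' (hl' | hl')
          · exact (huM l' hl').trans (Nat.le_succ M)
          · exact hlb.hi_le l' hl'
        · exact hlb.exists_hi_eq.imp fun _ h => ⟨Or.inr h.1, h.2⟩)
    refine ⟨{l} ∪ p, M', hlb.union hp, ?_, fun u hu huM => ?_⟩
    · rw [span_union, span_singleton, hl]
      exact Submodule.mem_sup_left (basis_mem_supported e ⟨le_rfl, Nat.lt_succ_self M⟩)
    · rw [← union_assoc]
      exact hO _ ⟨u, ⟨hu, huM⟩, rfl⟩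
  choose p M' hp hpe hpO using step
  choose gap _ _ hgs hgb using fun m : ℕ => N.exists_isBlock_full (a := m) (b := m + c) (by omega)
  choose last _ _ hls hlb using fun m : ℕ => N.exists_isBlock_full (Nat.lt_succ_self m)
  let M : ℕ → ℕ := fun n => Nat.rec start (fun n m => M' n m + c + 1) n
  exact ⟨{
    M := M
    M' := fun n => M' n (M n)
    p := fun n => p n (M n)
    gap := fun n => gap (M' n (M n))
    last := fun n => last (M' n (M n) + c)
    M_zero := rfl
    M_succ := fun n => rfl
    p_isBlock := fun n => hp n _
    basis_mem := fun n => hpe n _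
    gap_isBlock := fun n => hgb _
    sub_gap := fun n => hgs _
    last_isBlock := fun n => hlb _
    basis_mem_last := fun n => by
      rw [hls]; exact basis_mem_supported e ⟨le_rfl, Nat.lt_succ_self _⟩
    cyl_subset := fun n => hpO n _ }⟩

/-- If Y is the span of some F n on its own interval, keep the labels F n with T = 0; otherwise
approximate Y by a single net label. The first case must be exact, since genericity depends on the
labels and not only on their span. -/
theorem exists_block_perturbation {a b : ℕ} (hab : a < b) {Y : Submodule 𝕜 X}
    (hY : Y ≤ supported e (Ico a b)) {j : ℕ} (hj : j ≤ b) {F : ℕ → Set ℕ} {M : ℕ → ℕ}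
    (hM : StrictMono M) (hF : ∀ n, N.IsBlock (F n) (M n) (M (n + 1))) :
    ∃ (Q : Set ℕ) (T : X →L[𝕜] X), N.Separated Q ∧ (∀ l ∈ Q, a ≤ N.lo l) ∧ (∀ l ∈ Q, N.hi l ≤ b) ∧
      ‖T‖ ≤ (1 / 2) ^ (j + 2) ∧ (∀ x ∈ supported e (Ico a b)ᶜ, T x = 0) ∧
      Y.map (LinearMap.id + T.toLinearMap) = N.span Q ∧
      ∀ n, Y = N.span (F n) → a = M n → b = M (n + 1) → Q = F n ∧ T = 0 := by
  by_cases h : ∃ n, Y = N.span (F n) ∧ a = M n ∧ b = M (n + 1)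
  · obtain ⟨n, rfl, rfl, rfl⟩ := h
    refine ⟨F n, 0, (hF n).separated, (hF n).le_lo, (hF n).hi_le, by simp, by simp, ?_, ?_⟩
    · simp
    · intro m _ hm _
      exact ⟨by rw [hM.injective hm], rfl⟩
  · obtain ⟨l, h1, h2, T, hT, hT0, hTY⟩ := N.approx a b hab Y hY
    refine ⟨{l}, T, N.separated_singleton l, ?_, ?_, hT.trans ?_, hT0, ?_, ?_⟩
    · rintro _ rfl; exact h1.ge
    · rintro _ rfl; exact h2.le
    · exact pow_le_pow_of_le_one (by norm_num) (by norm_num) (by omega)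
    · rw [hTY, span_singleton]
    · exact fun n h1 h2 h3 => absurd ⟨n, h1, h2, h3⟩ h

theorem separated_iUnion {a b : ℕ → ℕ} {Y : ℕ → Submodule 𝕜 X} (hY : IsBlocking e a b Y)
    {Q : ℕ → Set ℕ} (hQ : ∀ j, N.Separated (Q j)) (hQa : ∀ j, ∀ l ∈ Q j, a j ≤ N.lo l)
    (hQb : ∀ j, ∀ l ∈ Q j, N.hi l ≤ b j) : N.Separated (⋃ j, Q j) := by
  intro l hl l' hl' hne
  obtain ⟨j, hj⟩ := mem_iUnion.1 hl
  obtain ⟨k, hk⟩ := mem_iUnion.1 hl'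
  obtain h | rfl | h := lt_trichotomy j k
  · exact Or.inl ((hQb j l hj).trans ((hY.le_of_lt h).trans (hQa k l' hk)))
  · exact hQ j l hj l' hk hne
  · exact Or.inr ((hQb k l' hk).trans ((hY.le_of_lt h).trans (hQa j l hj)))

namespace Anchor

variable {N} {O : ℕ → Set N.Space} {start c : ℕ} (s : N.Anchor O start c)

/-- The set of the labels of the block `n` of an anchor, without the label on the gap. -/
def block (n : ℕ) : Set ℕ := s.p n ∪ {s.last n}

/-- The sequence of the spans of the blocks of an anchor. -/
def seq (n : ℕ) : Submodule 𝕜 X := N.span (s.block n)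

theorem block_isBlock (n : ℕ) : N.IsBlock (s.block n) (s.M n) (s.M (n + 1)) :=
  (s.p_isBlock n).union ((s.last_isBlock n).mono_left (Nat.le_add_right _ _))

theorem strictMono_M : StrictMono s.M := strictMono_nat_of_lt_succ fun n => (s.block_isBlock n).lt

theorem start_le (n : ℕ) : start ≤ s.M n := 
  s.M_zero.ge.trans (s.strictMono_M.monotone (Nat.zero_le n))

theorem basis_mem_seq (n : ℕ) : e (s.M n) ∈ s.seq n := by
  rw [seq, block, span_union]
  exact Submodule.mem_sup_left (s.basis_mem n)

theorem basis_last_mem_seq (n : ℕ) : e (s.M' n + c) ∈ s.seq n := by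
  rw [seq, block, span_union, span_singleton]
  exact Submodule.mem_sup_right (s.basis_mem_last n)

theorem isFDDSeq_seq : IsFDDSeq e s.seq where
  finiteDimensional n := (s.block_isBlock n).finiteDimensional_span
  ne_bot n h := by
    have h1 := s.basis_mem_seq n
    rw [h, Submodule.mem_bot] at h1
    have h2 := coord_basis e (s.M n) (s.M n)
    rw [h1, map_zero, if_pos rfl] at h2
    exact zero_ne_one h2
  successive n := by
    intro x hx y hy i hi j hj
    have h1 : i ∈ Ico (s.M n) (s.M (n + 1)) :=
      by_contra fun h => hi ((s.block_isBlock n).span_le hx i h)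
    have h2 : j ∈ Ico (s.M (n + 1)) (s.M (n + 1 + 1)) :=
      by_contra fun h => hj ((s.block_isBlock (n + 1)).span_le hy j h)
    exact h1.2.trans_le h2.1

/-- The subspace contains the first and the last basis vector of the anchor interval, so it
determines that interval. This is the role of `last`: the gap lies strictly inside the span of
supports, so the other terms of a decomposition through `s.seq n` avoid it. -/
theorem interval_eq {E : Submodule 𝕜 X} {n a b i : ℕ} (h : E = s.seq n)
    (hE : E ≤ supported e (Ico a b)) (ha : ∃ x ∈ E, e.coord a x ≠ 0) (hb : b = i + 1)
    (hi : ∃ x ∈ E, e.coord i x ≠ 0) : a = s.M n ∧ b = s.M (n + 1) := by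
  have key : ∀ j, (∃ x ∈ E, e.coord j x ≠ 0) → j ∈ Ico (s.M n) (s.M (n + 1)) := by
    rintro j ⟨x, hx, hj⟩
    exact by_contra fun h' => hj ((s.block_isBlock n).span_le (h.le hx) j h')
  have key' : ∀ j, e j ∈ E → j ∈ Ico a b := by
    intro j hj
    by_contra h'
    have := hE hj j h'
    rw [coord_basis, if_pos rfl] at this
    exact one_ne_zero this
  have h1 := key a ha
  have h2 := key i hi
  have h3 := key' _ (h.ge (s.basis_mem_seq n))
  have h4 := key' _ (h.ge (s.basis_last_mem_seq n))
  have h5 := s.M_succ n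
  simp only [mem_Ico] at h1 h2 h3 h4
  omega

end Anchor
end BlockNet
end ErgodicBanach

namespace ErgodicBanach

/-! ### Comparison of an arbitrary decomposition with a generic point. -/

namespace BlockNet

variable {𝕜 : Type*} [RCLike 𝕜] {X : Type*} [NormedAddCommGroup X] [NormedSpace 𝕜 X]
  {e : SchauderBasis 𝕜 X} {N : BlockNet e}

namespace Anchor

variable {O : ℕ → Set N.Space} {start c : ℕ} (s : N.Anchor O start c)

/-- Only labels ending by `s.M' n` matter, so filling the gap after `s.p n` does not spoil
membership. -/
theorem mem_of_block_subset {x : N.Space} {n : ℕ} (hx : s.block n ⊆ x.toSet)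
    (hgap : ∀ l ∈ x.toSet, N.hi l ≤ s.M' n → s.M n < N.hi l → l ∈ s.p n) : x ∈ O n := by
  refine s.cyl_subset n {l ∈ x.toSet | N.hi l ≤ s.M n}
    (Separated.mono (T := x.toSet) x.2 fun l hl => hl.1) (fun l hl => hl.2) ?_
  intro l hl
  constructor
  · intro hlx
    by_cases h : N.hi l ≤ s.M n
    · exact Or.inl ⟨hlx, h⟩
    · exact Or.inr (hgap l hlx hl (not_le.1 h))
  · rintro (h | h)
    · exact h.1
    · exact hx (Or.inl h)

/-- A configuration obtained from `t`, the gap label number `n₁`, and sets of labels on the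
intervals of a blocking that contain infinitely many blocks of the anchor. -/
theorem exists_point (hO : Antitone O) {t : Set ℕ} (ht : N.IsBlock t 0 start) {a b : ℕ → ℕ}
    {Y : ℕ → Submodule 𝕜 X} (hY : IsBlocking e a b Y) (ha : a 0 = start) {Q : ℕ → Set ℕ}
    (hQ : ∀ j, N.Separated (Q j)) (hQa : ∀ j, ∀ l ∈ Q j, a j ≤ N.lo l)
    (hQb : ∀ j, ∀ l ∈ Q j, N.hi l ≤ b j)
    (hinf : {n | ∃ j, a j = s.M n ∧ b j = s.M (n + 1) ∧ Q j = s.block n}.Infinite) {n₁ j₁ : ℕ}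
    (h1a : a j₁ = s.M n₁) (h1b : b j₁ = s.M (n₁ + 1)) (h1Q : Q j₁ = s.block n₁) :
    ∃ x ∈ N.cyl t start, (∀ n, x ∈ O n) ∧ x.toSet = t ∪ ((⋃ j, Q j) ∪ {s.gap n₁}) := by
  have hgaplo : s.M' n₁ ≤ N.lo (s.gap n₁) := (s.gap_isBlock n₁).le_lo _ rfl
  have hgaphi : N.hi (s.gap n₁) ≤ s.M' n₁ + c := (s.gap_isBlock n₁).hi_le _ rfl
  have hlt := fun n => (s.p_isBlock n).lt
  have hMs := s.M_succ
  have hsa : ∀ j, start ≤ a j := fun j => ha ▸ hY.strictMono.monotone (Nat.zero_le j)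
  -- Count the gap label as part of the piece `j₁`, where it fits between `s.p n₁` and `s.last n₁`.
  have hgapQ : N.Separated ((⋃ j, Q j) ∪ {s.gap n₁}) := by
    have : (⋃ j, Q j) ∪ {s.gap n₁} = ⋃ j, (Q j ∪ {l | l = s.gap n₁ ∧ j = j₁}) := by
      ext l
      simp only [mem_union, mem_iUnion, mem_singleton_iff, mem_ofPred_eq, exists_or, exists_and_left,
        exists_eq, and_true]
    rw [this]
    refine N.separated_iUnion hY (fun j => ?_) (fun j => ?_) fun j => ?_
    · by_cases hj : j = j₁
      · subst hj
        have hset : Q j ∪ {l | l = s.gap n₁ ∧ j = j} = (s.p n₁ ∪ {s.gap n₁}) ∪ {s.last n₁} := by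
          rw [h1Q, block]
          ext l
          simp only [mem_union, mem_singleton_iff, mem_ofPred_eq, and_true]
          tauto
        rw [hset]
        exact (((s.p_isBlock n₁).union (s.gap_isBlock n₁)).union (s.last_isBlock n₁)).separated
      · simpa [hj] using hQ j
    · rintro l (hl | ⟨rfl, rfl⟩)
      · exact hQa j l hl
      · have := hlt n₁; omega
    · rintro l (hl | ⟨rfl, rfl⟩)
      · exact hQb j l hl
      · have := hMs n₁; omega
  have hlo : ∀ l ∈ (⋃ j, Q j) ∪ {s.gap n₁}, start ≤ N.lo l := by
    rintro l (hl | rfl)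
    · obtain ⟨j, hj⟩ := mem_iUnion.1 hl
      exact (hsa j).trans (hQa j l hj)
    · exact (s.start_le n₁).trans ((hlt n₁).le.trans hgaplo)
  let x : N.Space := ofSet (ht.separated.union hgapQ ht.hi_le hlo)
  have hx : x.toSet = t ∪ ((⋃ j, Q j) ∪ {s.gap n₁}) := toSet_ofSet N _
  refine ⟨x, ?_, fun n => ?_, hx⟩
  · refine cyl_union_subset le_rfl hlo ?_
    rw [← hx]
    exact N.mem_cyl_toSet x start
  obtain ⟨m, ⟨j, hja, hjb, hjQ⟩, hnm⟩ := hinf.exists_gt n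
  refine hO hnm.le (s.mem_of_block_subset ?_ fun l hl h1 h2 => ?_)
  · rw [hx, ← hjQ]
    exact fun l hl => Or.inr (Or.inl (mem_iUnion.2 ⟨j, hl⟩))
  · have hMm := hMs m
    rw [hx] at hl
    obtain hl | hl | rfl := hl
    · have := ht.hi_le l hl
      have := s.start_le m
      omega
    · obtain ⟨k, hk⟩ := mem_iUnion.1 hl
      obtain h | rfl | h := lt_trichotomy j k
      · have := hY.le_of_lt h
        have := hQa k l hk
        have := N.lo_lt_hi l
        omega
      · rw [hjQ] at hk
        refine hk.resolve_right ?_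
        rintro rfl
        have := (s.last_isBlock m).le_lo _ rfl
        have := N.lo_lt_hi (s.last m)
        omega
      · have := hY.le_of_lt h
        have := hQb k l hk
        omega
    · exfalso
      have hll := N.lo_lt_hi (s.gap n₁)
      obtain h | rfl | h := lt_trichotomy m n₁
      · have := s.strictMono_M.monotone h
        have := hlt n₁
        simp only [Nat.succ_eq_add_one] at *
        omega
      · omega
      · have := s.strictMono_M.monotone h
        have := hMs n₁
        simp only [Nat.succ_eq_add_one] at *
        omega

/-- The removed piece A, of dimension start + 1, is exchanged for V, the span of t and of one gap.
The factor 5 ^ (start + 1) pays for this exchange and 2 for the perturbation into the net. -/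
theorem exists_isoWithin [CompleteSpace X] (hO : Antitone O) {t : Set ℕ}
    (ht : N.IsBlock t 0 start) (hc : Module.finrank 𝕜 (N.span t) + c = start + 1)
    {E : ℕ → Submodule 𝕜 X} (hE : IsFDDSeq e E) (hEs : PassesThroughInfinitelyMany E s.seq) :
    ∃ x ∈ N.cyl t start, (∀ n, x ∈ O n) ∧
      IsoWithin (5 ^ (start + 1) * 2) (⨆ k, E k).topologicalClosure
        (N.span x.toSet).topologicalClosure := by
  obtain ⟨a, b, hab, hea, heb⟩ := hE.exists_isBlocking
  obtain ⟨a', b', Y, A, hY, ha0, hYE, _, hA, hsup, hd⟩ := hab.exists_cut hE.ne_bot start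
  choose Q T hQ hQa hQb hT hT0 hTY hQs using fun j =>
    N.exists_block_perturbation (hY.lt j) (hY.le_supported j)
      ((hY.strictMono.le_apply (x := j)).trans (hY.lt j).le) s.strictMono_M s.block_isBlock
  have hinf' : {n | ∃ j, a' j = s.M n ∧ b' j = s.M (n + 1) ∧ Y j = s.seq n}.Infinite := by
    -- Dropping n ≤ `a start` leaves only terms with index k > start, since `a start` < n ≤ `s.M n`
    -- = `a k`; the cut does not touch these.
    refine (hEs.sdiff (finite_Iic (a start))).mono ?_
    rintro n ⟨⟨k, hk⟩, hn⟩
    obtain ⟨i, hbi, hi⟩ := heb k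
    obtain ⟨h1, h2⟩ := s.interval_eq hk (hab.le_supported k) (hea k) hbi hi
    have hk' : start < k := by
      rw [← hab.strictMono.lt_iff_lt, h1]
      exact (not_le.1 hn).trans_le s.strictMono_M.le_apply
    obtain ⟨j, hj1, hj2, hj3⟩ := hYE k hk'
    exact ⟨j, hj2.trans h1, hj3.trans h2, hj1.trans hk⟩
  obtain ⟨n₁, j₁, h1a, h1b, h1Y⟩ := hinf'.nonempty
  obtain ⟨h1Q, h1T⟩ := hQs j₁ n₁ h1Y h1a h1b
  obtain ⟨x, hxt, hxO, hx⟩ := s.exists_point hO ht hY ha0 hQ hQa hQb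
    (hinf'.mono (by rintro n ⟨j, h1, h2, h3⟩; exact ⟨j, h1, h2, (hQs j n h3 h1 h2).1⟩)) h1a h1b h1Q
  refine ⟨x, hxt, hxO, ?_⟩
  have hsM := s.start_le n₁
  have hMlt := (s.p_isBlock n₁).lt
  have hMs := s.M_succ n₁
  have hsa : ∀ j, start ≤ a' j := fun j => ha0 ▸ hY.strictMono.monotone (Nat.zero_le j)
  have hdj : ∀ {J K : Set ℕ}, (∀ i ∈ J, i ∉ K) → Disjoint (supported e J) (supported e K) :=
    fun h => disjoint_supported e (disjoint_left.2 h)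
  have hT0' : ∀ (j : ℕ) (J : Set ℕ), (∀ i ∈ J, i ∉ Ico (a' j) (b' j)) →
      ∀ y ∈ supported e J, T j y = 0 := fun j J h y hy => hT0 j y (supported_mono e h hy)
  have := ht.finiteDimensional_span
  set G : Set ℕ := Ico (s.M' n₁) (s.M' n₁ + c)
  set V := N.span t ⊔ N.sub (s.gap n₁)
  have hVfr : Module.finrank 𝕜 V = start + 1 := by
    rw [finrank_sup_of_disjoint, s.sub_gap, finrank_supported_Ico]
    · omega
    · rw [s.sub_gap]
      refine (hdj fun i hi hi' => ?_).mono_left ht.span_le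
      have := hi.2
      have := hi'.1
      omega
  have hYJ : ∀ j, Y j ≤ supported e (Ici start \ G) := by
    intro j
    by_cases hj : j = j₁
    · subst hj
      rw [h1Y, seq, block, span_union, span_singleton, sup_le_iff]
      refine ⟨(s.p_isBlock n₁).span_le.trans (supported_mono e ?_),
        (span_singleton N (s.last n₁) ▸ (s.last_isBlock n₁).span_le).trans (supported_mono e ?_)⟩
      · exact fun i hi => ⟨hsM.trans hi.1, fun h => not_lt.2 h.1 hi.2⟩
      · exact fun i hi => ⟨(hsM.trans hMlt.le).trans ((Nat.le_add_right _ _).trans hi.1),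
          fun h => not_lt.2 hi.1 h.2⟩
    · refine (hY.le_supported j).trans (supported_mono e fun i hi => ⟨(hsa j).trans hi.1, fun h => ?_⟩)
      refine disjoint_left.1 (hY.disjoint hj) hi ⟨?_, ?_⟩
      · have := h.1
        omega
      · have := h.2
        omega
  have hdV : Disjoint (⨆ j, Y j).topologicalClosure V := by
    refine (hdj (J := Ici start \ G) (K := Ico 0 start ∪ G) ?_).mono
      (Submodule.topologicalClosure_minimal _ (iSup_le hYJ) (isClosed_supported e _)) (sup_le ?_ ?_)
    · rintro i ⟨h1, h2⟩ (h3 | h3)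
      · exact not_lt.2 h1 h3.2
      · exact h2 h3
    · exact ht.span_le.trans (supported_mono e subset_union_left)
    · exact (s.sub_gap n₁).le.trans (supported_mono e subset_union_right)
  have hiso1 := isoWithin_topologicalClosure_sup hA hVfr hd hdV
  rw [← hsup] at hiso1
  obtain ⟨S, hS, hST⟩ := exists_perturbation hT
  -- Each `T j` vanishes off its own interval. The stem t lies before all of them, and the gap meets
  -- only the interval `j₁`, on which T is zero because the anchor block is kept exactly.
  have hSid : ∀ y ∈ V, S y = y := by
    have key : ∀ y, (∀ j, T j y = 0) → S y = y := fun y hy => by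
      rw [hST 0 y fun i _ => hy i]
      simp [hy 0]
    have hle : V ≤ LinearMap.eqLocus S LinearMap.id := by
      refine sup_le (fun y hy => key y fun j => ?_) (fun y hy => key y fun j => ?_)
      · refine hT0' j _ (fun i hi h => ?_) y (ht.span_le hy)
        exact not_lt.2 ((hsa j).trans h.1) hi.2
      · rw [s.sub_gap] at hy
        by_cases hj : j = j₁
        · rw [hj, h1T]; rfl
        · refine hT0' j _ (fun i hi h => ?_) y hy
          refine disjoint_left.1 (hY.disjoint hj) h ⟨?_, ?_⟩
          · have := hi.1
            omega
          · have := hi.2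
            omega
    exact fun y hy => hle hy
  have hSV : V.map S = V := by
    ext y
    constructor
    · rintro ⟨z, hz, rfl⟩
      rwa [hSid z hz]
    · exact fun hy => ⟨y, hy, hSid y hy⟩
  have hSY : ∀ j, (Y j).map S = N.span (Q j) := by
    intro j
    rw [← hTY j]
    refine SetLike.coe_injective (image_congr fun y hy => hST j y fun i hi => ?_)
    refine hT0' i _ (fun k hk h => ?_) y (hY.le_supported j hy)
    exact disjoint_left.1 (hY.disjoint hi) h hk
  have hmap : ((⨆ j, Y j) ⊔ V).map S = N.span x.toSet := by
    rw [Submodule.map_sup, Submodule.map_iSup, hSV, hx, span_union, span_union, span_iUnion,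
      span_singleton]
    simp only [hSY]
    rw [sup_left_comm]
  have hiso2 := (isoWithin_of_linearMap (L := 2) S ((⨆ j, Y j) ⊔ V)
    fun y _ => hS y).topologicalClosure
  rw [hmap] at hiso2
  exact hiso1.trans (by positivity) (by norm_num) hiso2

end Anchor

theorem exists_uniform_seq [CompleteSpace X] {L : ℕ} (h : ¬ IsMeagre {z : N.Space × N.Space |
    IsoWithin (L : ℝ) (N.span z.1.toSet).topologicalClosure
      (N.span z.2.toSet).topologicalClosure}) :
    ∃ (K : ℝ) (Z : Submodule 𝕜 X) (F : ℕ → Submodule 𝕜 X), 1 ≤ K ∧ IsFDDSeq e F ∧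
      ∀ E : ℕ → Submodule 𝕜 X, IsFDDSeq e E → PassesThroughInfinitelyMany E F →
        IsoWithin K (⨆ k, E k).topologicalClosure Z := by
  obtain ⟨x₀, t, n, O, ht, hOo, hOd, hOa, hO⟩ := N.exists_generic_cyl h
  have hfr : Module.finrank 𝕜 (N.span t) ≤ n := by
    have := finiteDimensional_supported e (finite_Ico 0 n)
    simpa [finrank_supported_Ico] using Submodule.finrank_mono ht.span_le
  -- The gap has length c = n + 1 - rank of t. Aiming at n + 1 rather than n makes it positive, as
  -- the interval of a label must be nonempty.
  obtain ⟨c, hc⟩ := Nat.exists_eq_add_of_le (Nat.le_succ_of_le hfr)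
  obtain ⟨s⟩ := N.nonempty_anchor hOo hOd n (c := c) (by omega)
  refine ⟨5 ^ (n + 1) * 2 * (L + 1), (N.span x₀.toSet).topologicalClosure, s.seq, ?_,
    s.isFDDSeq_seq, fun E hE hEs => ?_⟩
  · have h1 : (1 : ℝ) ≤ 5 ^ (n + 1) := one_le_pow₀ (by norm_num)
    have h2 : (0 : ℝ) ≤ L := Nat.cast_nonneg L
    nlinarith
  · obtain ⟨x, hxt, hxO, hiso⟩ := s.exists_isoWithin hOa ht (by omega) hE hEs
    exact hiso.trans (by positivity) (by positivity)
      ((hO x hxt hxO).symm.mono (by linarith))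

end BlockNet
end ErgodicBanach

theorem mainTheorem8 {𝕜 : Type*} [RCLike 𝕜] {X : Type*} [NormedAddCommGroup X]
    [NormedSpace 𝕜 X] [CompleteSpace X] (e : SchauderBasis 𝕜 X) :
    ErgodicBanach.IsErgodic 𝕜 X ∨
      ∃ K : ℝ, 1 ≤ K ∧ ∃ F : ℕ → Submodule 𝕜 X, ErgodicBanach.IsFDDSeq e F ∧
        ∀ E E' : ℕ → Submodule 𝕜 X,
          ErgodicBanach.IsFDDSeq e E → ErgodicBanach.IsFDDSeq e E' →
          ErgodicBanach.PassesThroughInfinitelyMany E F →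
          ErgodicBanach.PassesThroughInfinitelyMany E' F →
          ErgodicBanach.IsKIsomorphic K (ErgodicBanach.fddSpace E) (ErgodicBanach.fddSpace E') := by
  obtain ⟨N⟩ := ErgodicBanach.nonempty_blockNet e
  by_cases h : ∀ L : ℕ, IsMeagre {z : N.Space × N.Space |
    ErgodicBanach.IsoWithin (L : ℝ) (N.span z.1.toSet).topologicalClosure
      (N.span z.2.toSet).topologicalClosure}
  · exact Or.inl (N.isErgodic_of_isMeagre h)
  · obtain ⟨L, hL⟩ := not_forall.1 h
    obtain ⟨K, Z, F, hK, hF, hEF⟩ := ErgodicBanach.BlockNet.exists_uniform_seq hL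
    -- Going through Z bounds each of the two norms by K * K; the product of the norms squares this.
    refine Or.inr ⟨K * K * (K * K), ?_, F, hF, fun E E' hE hE' hEs hEs' => ?_⟩
    · exact one_le_mul_of_one_le_of_one_le (one_le_mul_of_one_le_of_one_le hK hK)
        (one_le_mul_of_one_le_of_one_le hK hK)
    · have hK0 : 0 ≤ K := zero_le_one.trans hK
      exact ((hEF E hE hEs).trans hK0 hK0 (hEF E' hE' hEs').symm).isKIsomorphic
        (Y := ErgodicBanach.fddSpace E) (Z := ErgodicBanach.fddSpace E') (mul_nonneg hK0 hK0)
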